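/- Write $[n]=\{1,\dots,n\}$ and $\mathbb T=\mathbb R\cup\{\infty\}$ (min-plus conventions). For a finite set $E$ let $\mathbb P(\mathbb T^E)=(\mathbb T^E\setminus\{(\infty,\dots,\infty)\})/\mathbb R\mathbf 1$, let the support of $u\in\mathbb T^E$ be $\{i: u_i\neq\infty\}$, and let $T_S\subseteq\mathbb P(\mathbb T^E)$ be the set of points with support $S$. "The minimum of a finite family in $\mathbb T$ is attained at least twice" is understood to hold also if all members are $\infty$. A valuated matroid with underlying matroid $M$ is a function $\mu:\mathcal B(M)\to\mathbb R$ on the bases (extended by $\infty$ to all other subsets) such that for all $B,B'\in\mathcal B(M)$ and $i\in B\setminus B'$ there is $j\in B'\setminus B$ with $\mu(B)+\mu(B')\ge\mu(B\setminus i\cup j)+\mu(B'\setminus j\cup i)$. A sequence $\boldsymbol M=(M_1,\dots,M_k)$ of matroids on $[n]$ is a flag matroid if for all $i<j$ the matroid $M_i$ is a quotient of $M_j$, i.e. $\operatorname{rk}_{M_i}(B)-\operatorname{rk}_{M_i}(A)\le\operatorname{rk}_{M_j}(B)-\operatorname{rk}_{M_j}(A)$ for all $A\subseteq B\subseteq[n]$.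 Its base polytope is $Q(\boldsymbol M)=\operatorname{Conv}(\mathbf e_{B_1}+\dots+\mathbf e_{B_k} : B_i\in\mathcal B(M_i))\subset\mathbb R^{[n]}$. **Theorem.** Let $\boldsymbol\mu=(\mu_1,\dots,\mu_k)$ be a sequence of valuated matroids on $[n]$ whose sequence of underlying matroids $\boldsymbol M=(M_1,\dots,M_k)$, of ranks $(r_1,\dots,r_k)$, is a flag matroid. Then the following are equivalent. (a) $\boldsymbol\mu$ is a point of the flag Dressian $FlDr(\boldsymbol M)$: the set of points of $\prod_i\mathbb P(\mathbb T^{\binom{[n]}{r_i}})$ whose $i$-th component lies in $T_{\mathcal B(M_i)}$ for all $i$, and which lie in the multi-projective tropical prevariety (the minimum over the terms is attained at least twice) of the tropical Grassmann–Plücker relations $P_IP_J\oplus\bigoplus_{j\in J\setminus I}P_{I\setminus a\cup j}P_{J\setminus j\cup a}$ ($I,J\in\binom{[n]}{r_i}$, $|I\cap J|<r_i-1$, $a\in I\setminus J$) for each $i$, and of the tropical incidence-Plücker relations $\bigoplus_{a\in J'\setminus I'}P_{I'\cup a}P_{J'\setminus a}$ ($I'\in\binom{[n]}{r_i-1}$,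 $J'\in\binom{[n]}{r_j+1}$) for all $i<j$, where $P_{I'\cup a}$ is a coordinate of the $i$-th and $P_{J'\setminus a}$ of the $j$-th factor. (b) $\boldsymbol\mu$ is a valuated flag matroid: for all $i<j$, $I\in\mathcal B(M_i)$, $J\in\mathcal B(M_j)$ and $a\in I\setminus J$ there is $b\in J\setminus I$ with $\mu_i(I)+\mu_j(J)\ge\mu_i(I\setminus a\cup b)+\mu_j(J\setminus b\cup a)$. (c) $\boldsymbol\mu$ induces a subdivision of $Q(\boldsymbol M)$ into base polytopes of flag matroids: each face $F$ of the coherent subdivision of the point configuration $(B_1,\dots,B_k)\mapsto\mathbf e_{B_1}+\dots+\mathbf e_{B_k}$ on $\prod_i\mathcal B(M_i)$ induced by the weight $w(B_1,\dots,B_k)=\mu_1(B_1)+\dots+\mu_k(B_k)$ (the faces are the sets of minimizers of $w(B_1,\dots,B_k)+\langle u,\mathbf e_{B_1}+\dots+\mathbf e_{B_k}\rangle$, for $u\in\mathbb R^{[n]}$) has as its convex hull $\operatorname{Conv}(F)$ the base polytope of a flag matroid on $[n]$. (d) The projective tropical linear spaces form a chain $\overline{\operatorname{trop}}(\mu_1)\subseteq\dots\subseteq\overline{\operatorname{trop}}(\mu_k)$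 in $\mathbb P(\mathbb T^{[n]})$. Here $\overline{\operatorname{trop}}(\mu)=\bigcup_{S\subsetneq[n]}\operatorname{trop}(\mu/_S)\times\{\infty\}^S$; the contraction $\mu/_S$ is the valuated matroid on $[n]\setminus S$ with $\mu/_S(B)=\mu(B\cup I_S)$ for a fixed maximal independent subset $I_S$ of $S$ (well defined up to an additive constant); and for a valuated matroid $\nu$ of rank $r$ on a set $E$, $\operatorname{trop}(\nu)\subseteq\mathbb R^E/\mathbb R\mathbf 1$ is the set of $\overline u$ such that, for each valuated circuit $C$ of $\nu$, the minimum of $C_i+u_i$ over $i\in\operatorname{supp}(C)$ is attained at least twice, the valuated circuits being the vectors $C\neq(\infty,\dots,\infty)$ given, for an $(r+1)$-subset $S$ of $E$, by $C_i=\nu(S\setminus i)$ for $i\in S$ and $C_i=\infty$ for $i\notin S$. -/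

import Mathlib

open Set

noncomputable section

namespace FlagTrop

open Classical in
/-- The minimum of the family `(f v)_{v ∈ s}` is achieved at least twice; by convention this
also holds when all members of the family are `∞`. -/
def MinAchievedTwice {ι : Type*} (s : Finset ι) (f : ι → WithTop ℝ) : Prop :=
  (∀ v ∈ s, f v = ⊤) ∨
    ∃ v ∈ s, ∃ w ∈ s, v ≠ w ∧ f v = f w ∧ ∀ x ∈ s, f v ≤ f x

/-! ### Tropical projective spaces -/

/-- Representatives of points of the tropical projective space: vectors in `𝕋^E`,
`𝕋 = ℝ ∪ {∞}`, which are not constantly `∞`. -/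
abbrev ProjRep (E : Type*) : Type _ := {u : E → WithTop ℝ // u ≠ fun _ => ⊤}

/-- Two vectors are identified if they differ by a real multiple of the all-ones vector. -/
instance projSetoid (E : Type*) : Setoid (ProjRep E) where
  r u v := ∃ c : ℝ, ∀ i, v.1 i = u.1 i + (c : WithTop ℝ)
  iseqv :=
    { refl := fun u => ⟨0, fun i => by simp⟩
      symm := by
        rintro u v ⟨c, hc⟩
        refine ⟨-c, fun i => ?_⟩
        rw [hc i, add_assoc, ← WithTop.coe_add]
        simp
      trans := by
        rintro u v w ⟨c, hc⟩ ⟨d, hd⟩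
        refine ⟨c + d, fun i => ?_⟩
        rw [hd i, hc i, add_assoc, ← WithTop.coe_add] }

/-- The tropical projective space `ℙ(𝕋^E)`. -/
abbrev TropProj (E : Type*) : Type _ := Quotient (projSetoid E)

/-- The support of a vector in `𝕋^E`. -/
def tsupp {E : Type*} (u : E → WithTop ℝ) : Set E := {i | u i ≠ ⊤}

/-- The stratum `T_S ⊆ ℙ(𝕋^E)` of points with support `S`. -/
def stratum {E : Type*} (S : Set E) : Set (TropProj E) :=
  {p | ∃ u : ProjRep E, ⟦u⟧ = p ∧ tsupp u.1 = S}

/-! ### Tropical polynomials and prevarieties -/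

/-- A tropical polynomial in the variables `E`: a finite set of exponent vectors, with a real
coefficient for each of them. -/
structure TropPoly (E : Type*) where
  support : Finset (E →₀ ℕ)
  coeff : support → ℝ

/-- The value `c_v + ∑ᵢ vᵢ uᵢ` of a term of a tropical polynomial (with `0 · ∞ = 0`). -/
def TropPoly.term {E : Type*} (F : TropPoly E) (u : E → WithTop ℝ) (v : F.support) :
    WithTop ℝ :=
  (F.coeff v : WithTop ℝ) + v.1.sum fun i m => m • u i

/-- The tropical polynomial `F` vanishes tropically at `u`. -/
def TropPoly.VanishesAt {E : Type*} (F : TropPoly E) (u : E → WithTop ℝ) : Prop :=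
  MinAchievedTwice Finset.univ (F.term u)

/-- The multi-projective tropical hypersurface, in `∏ᵢ ℙ(𝕋^{E i})`, of a multi-homogeneous
tropical polynomial in the variables `⨆ᵢ E i`. -/
def multiHypersurface {J : Type*} {E : J → Type*} (F : TropPoly (Σ j, E j)) :
    Set (∀ j, TropProj (E j)) :=
  {p | ∃ u : ∀ j, ProjRep (E j), (∀ j, ⟦u j⟧ = p j) ∧
    F.VanishesAt fun x => (u x.1).1 x.2}

/-- The multi-projective tropical prevariety of a set of multi-homogeneous tropical
polynomials. -/
def multiPrevariety {J : Type*} {E : J → Type*} (𝓕 : Set (TropPoly (Σ j, E j))) :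
    Set (∀ j, TropProj (E j)) :=
  ⋂ F ∈ 𝓕, multiHypersurface F

open Classical in
/-- The tropical polynomial `⨁_{(a, b) ∈ T} x_a ⊙ x_b`. -/
def quadPoly {V : Type*} (T : Finset (V × V)) : TropPoly V where
  support := T.image fun t => Finsupp.single t.1 1 + Finsupp.single t.2 1
  coeff := fun _ => 0

/-! ### Flag Dressians -/

/-- The `r`-element subsets of `[n]`. -/
abbrev RSubset (n r : ℕ) : Type := {I : Finset (Fin n) // I.card = r}

/-- The variables `P_I`, for `I` an `r_i`-subset of `[n]` and `i = 1, …, k`; the variables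
for different indices `i` are different, even if the `r_i` coincide. -/
abbrev FlagVar (n : ℕ) {k : ℕ} (r : Fin k → ℕ) : Type := Σ i, RSubset n (r i)

open Classical in
/-- The tropical Grassmann-Plücker relations
`P_I ⊙ P_J ⊕ ⨁_{j ∈ J \ I} P_{I \ a ∪ j} ⊙ P_{J \ j ∪ a}` in the `i`-th group of variables, for
`|I ∩ J| < r_i - 1` and `a ∈ I \ J`. -/
def grassmannPlucker (n : ℕ) {k : ℕ} (r : Fin k → ℕ) (i : Fin k) :
    Set (TropPoly (FlagVar n r)) :=
  {F | ∃ I J : RSubset n (r i), ∃ a ∈ I.1 \ J.1, (I.1 ∩ J.1).card + 1 < r i ∧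
    F = quadPoly (Finset.image
      (fun t : RSubset n (r i) × RSubset n (r i) => (⟨i, t.1⟩, ⟨i, t.2⟩))
      {t | t = (I, J) ∨ ∃ j ∈ J.1 \ I.1,
        t.1.1 = insert j (I.1.erase a) ∧ t.2.1 = insert a (J.1.erase j)})}

open Classical in
/-- The tropical incidence-Plücker relations
`⨁_{a ∈ J' \ I'} P_{I' ∪ a} ⊙ P_{J' \ a}` between the `i`-th and the `j`-th group of variables,
for `|I'| = r_i - 1` and `|J'| = r_j + 1`. -/
def incidencePlucker (n : ℕ) {k : ℕ} (r : Fin k → ℕ) (i j : Fin k) :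
    Set (TropPoly (FlagVar n r)) :=
  {F | ∃ I' J' : Finset (Fin n), I'.card + 1 = r i ∧ J'.card = r j + 1 ∧
    F = quadPoly (Finset.image
      (fun t : RSubset n (r i) × RSubset n (r j) => (⟨i, t.1⟩, ⟨j, t.2⟩))
      {t | ∃ a ∈ J' \ I', t.1.1 = insert a I' ∧ t.2.1 = J'.erase a})}

/-- The flag Dressian `FlDr(r₁, …, r_k; n)`. -/
def flagDressian (n : ℕ) {k : ℕ} (r : Fin k → ℕ) :
    Set (∀ i, TropProj (RSubset n (r i))) :=
  multiPrevariety ((⋃ i, grassmannPlucker n r i) ∪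
    ⋃ i, ⋃ j, ⋃ _ : i < j, incidencePlucker n r i j)

/-- The rank of a matroid (on a finite ground set) as a natural number. -/
def rank {α : Type*} (M : Matroid α) : ℕ := M.eRank.toNat

/-- The flag Dressian `FlDr(M)` of a flag matroid `M = (M₁, …, M_k)`: the points of the flag
Dressian whose `i`-th component has support the set of bases of `M_i`. -/
def flagDressianOf {n k : ℕ} (M : Fin k → Matroid (Fin n)) :
    Set (∀ i, TropProj (RSubset n (rank (M i)))) :=
  flagDressian n (fun i => rank (M i)) ∩
    {p | ∀ i, p i ∈ stratum {B | (M i).IsBase (B.1 : Set (Fin n))}}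

/-! ### Matroid quotients and flag matroids -/

/-- `M` is a matroid quotient of `N`: they have the same ground set, and
`rk_M B - rk_M A ≤ rk_N B - rk_N A` for all subsets `A ⊆ B` of it. -/
def IsQuotient {α : Type*} (M N : Matroid α) : Prop :=
  M.E = N.E ∧ ∀ A B : Set α, A ⊆ B → B ⊆ N.E → M.eRk B + N.eRk A ≤ N.eRk B + M.eRk A

/-- A sequence of matroids on the ground set `[n]` is a flag matroid. -/
def IsFlagMatroid {n k : ℕ} (M : Fin k → Matroid (Fin n)) : Prop :=
  (∀ i, (M i).E = univ) ∧ ∀ i j, i < j → IsQuotient (M i) (M j)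

/-! ### Valuated matroids -/

/-- A valuated matroid on a subset of `α`. The valuation `μ` on the bases is extended by `∞` to
all finite sets which are not bases. -/
structure ValuatedMatroid (α : Type*) [DecidableEq α] where
  /-- the underlying matroid -/
  matroid : Matroid α
  /-- the valuation, extended by `∞` -/
  val : Finset α → WithTop ℝ
  val_ne_top_iff : ∀ B : Finset α, val B ≠ ⊤ ↔ matroid.IsBase (B : Set α)
  exchange : ∀ B B' : Finset α, matroid.IsBase (B : Set α) → matroid.IsBase (B' : Set α) →
    ∀ i ∈ B \ B', ∃ j ∈ B' \ B,
      val (insert j (B.erase i)) + val (insert i (B'.erase j)) ≤ val B + val B'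

/-- `μ` is a valuated matroid quotient of `ν`. -/
def IsValuatedQuotient {α : Type*} [DecidableEq α] (μ ν : ValuatedMatroid α) : Prop :=
  μ.matroid.E = ν.matroid.E ∧ rank μ.matroid ≤ rank ν.matroid ∧
  ∀ I J : Finset α, μ.matroid.IsBase (I : Set α) → ν.matroid.IsBase (J : Set α) →
    ∀ i ∈ I \ J, ∃ j ∈ J \ I,
      μ.val (insert j (I.erase i)) + ν.val (insert i (J.erase j)) ≤ μ.val I + ν.val J

/-- A sequence of valuated matroids on the ground set `[n]` is a valuated flag matroid. -/
def IsValuatedFlagMatroid {n k : ℕ} (μ : Fin k → ValuatedMatroid (Fin n)) : Prop :=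
  (∀ i, (μ i).matroid.E = univ) ∧ ∀ i j, i < j → IsValuatedQuotient (μ i) (μ j)

theorem card_eq_rank {α : Type*} {M : Matroid α} {B : Finset α} (hB : M.IsBase (B : Set α)) :
    B.card = rank M := by
  rw [rank, ← hB.encard_eq_eRank]
  simp

theorem exists_finset_isBase {α : Type*} [Finite α] (M : Matroid α) :
    ∃ B : Finset α, M.IsBase (B : Set α) := by
  obtain ⟨B, hB⟩ := M.exists_isBase
  exact ⟨B.toFinite.toFinset, by simpa using hB⟩

/-- The valuated matroid `μ` of rank `r` as a point of `ℙ(𝕋^([n] choose r))`. -/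
def ValuatedMatroid.toProj {n : ℕ} (μ : ValuatedMatroid (Fin n)) :
    TropProj (RSubset n (rank μ.matroid)) :=
  Quotient.mk _ ⟨fun B => μ.val B.1, fun h => by
    obtain ⟨B, hB⟩ := exists_finset_isBase μ.matroid
    exact (μ.val_ne_top_iff B).2 hB (congrFun h ⟨B, card_eq_rank hB⟩)⟩

/-! ### Contractions -/

theorem exists_finset_isBasis {α : Type*} [Finite α] (M : Matroid α) (S : Finset α) :
    ∃ I : Finset α, M.IsBasis' (I : Set α) (S : Set α) := by
  obtain ⟨I, hI⟩ := M.exists_isBasis' (S : Set α)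
  exact ⟨I.toFinite.toFinset, by simpa using hI⟩

/-- A chosen basis of the subset `S` of the matroid `M`. -/
def chosenBasis {α : Type*} [Finite α] (M : Matroid α) (S : Finset α) : Finset α :=
  (exists_finset_isBasis M S).choose

theorem chosenBasis_spec {α : Type*} [Finite α] (M : Matroid α) (S : Finset α) :
    M.IsBasis' (chosenBasis M S : Set α) (S : Set α) :=
  (exists_finset_isBasis M S).choose_spec

theorem contract_isBase_iff' {α : Type*} {M : Matroid α} {I S B : Set α}
    (hI : M.IsBasis' I S) :
    (M.contract S).IsBase B ↔ Disjoint B S ∧ M.IsBase (B ∪ I) := by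
  constructor
  · intro h
    obtain ⟨hBI, hd⟩ := hI.contract_indep_iff.1 h.indep
    obtain ⟨B', hB', hsub⟩ := hBI.exists_isBase_superset
    have hIB' : I ⊆ B' := subset_union_right.trans hsub
    have hIeq : I = B' ∩ S := hI.eq_of_subset_indep (hB'.indep.inter_right S)
      (subset_inter hIB' hI.subset) inter_subset_right
    have hind : (M.contract S).Indep (B' \ I) := by
      rw [hI.contract_indep_iff, sdiff_union_of_subset hIB']
      refine ⟨hB'.indep, Set.disjoint_left.2 fun x hxS hx => hx.2 ?_⟩
      rw [hIeq]
      exact ⟨hx.1, hxS⟩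
    have hBsub : B ⊆ B' \ I := fun x hx =>
      ⟨hsub (Or.inl hx), fun hxI => Set.disjoint_left.1 hd (hI.subset hxI) hx⟩
    have hBeq := h.eq_of_subset_indep hind hBsub
    refine ⟨hd.symm, ?_⟩
    rw [hBeq, sdiff_union_of_subset hIB']
    exact hB'
  · rintro ⟨hd, hB⟩
    rw [Matroid.isBase_iff_maximal_indep]
    refine ⟨hI.contract_indep_iff.2 ⟨hB.indep, hd.symm⟩, fun K hK hBK x hx => ?_⟩
    obtain ⟨hKI, hdK⟩ := hI.contract_indep_iff.1 hK
    have hEq := hB.eq_of_subset_indep hKI (union_subset_union_left I hBK)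
    have hxm : x ∈ B ∪ I := hEq ▸ Or.inl hx
    exact hxm.resolve_right fun hxI => Set.disjoint_left.1 hdK (hI.subset hxI) hx

/-- The contraction `μ/_S` of a valuated matroid by `S`: its value on `B` is `μ(B ∪ I)`, where
`I` is a chosen basis of `S`. Another choice of `I` changes the valuation by an additive
constant only. -/
def ValuatedMatroid.contract {α : Type*} [DecidableEq α] [Finite α] (μ : ValuatedMatroid α)
    (S : Finset α) : ValuatedMatroid α where
  matroid := μ.matroid.contract (S : Set α)
  val B := if Disjoint B S then μ.val (B ∪ chosenBasis μ.matroid S) else ⊤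
  val_ne_top_iff B := by
    rw [contract_isBase_iff' (chosenBasis_spec μ.matroid S), ← Finset.coe_union,
      ← μ.val_ne_top_iff, Finset.disjoint_coe]
    split_ifs with h <;> simp [h]
  exchange B B' hB hB' i hi := by
    have hspec := chosenBasis_spec μ.matroid S
    rw [contract_isBase_iff' hspec, ← Finset.coe_union, Finset.disjoint_coe] at hB hB'
    set I := chosenBasis μ.matroid S with hIdef
    have hIS : I ⊆ S := by exact_mod_cast hspec.subset
    have hdB := Finset.disjoint_left.1 hB.1
    have hdB' := Finset.disjoint_left.1 hB'.1
    rw [Finset.mem_sdiff] at hi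
    have hiI : i ∉ I := fun h => hdB hi.1 (hIS h)
    obtain ⟨j, hj, hle⟩ := μ.exchange _ _ hB.2 hB'.2 i (by simp [hi.1, hi.2, hiI])
    simp only [Finset.mem_sdiff, Finset.mem_union, not_or] at hj
    have hjB' : j ∈ B' := hj.1.resolve_right hj.2.2
    have e1 : insert j ((B ∪ I).erase i) = insert j (B.erase i) ∪ I := by
      rw [Finset.erase_union_distrib, Finset.erase_eq_of_notMem hiI, Finset.insert_union]
    have e2 : insert i ((B' ∪ I).erase j) = insert i (B'.erase j) ∪ I := by
      rw [Finset.erase_union_distrib, Finset.erase_eq_of_notMem hj.2.2, Finset.insert_union]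
    have d1 : Disjoint (insert j (B.erase i)) S := by
      rw [Finset.disjoint_insert_left]
      exact ⟨hdB' hjB', hB.1.mono_left (Finset.erase_subset _ _)⟩
    have d2 : Disjoint (insert i (B'.erase j)) S := by
      rw [Finset.disjoint_insert_left]
      exact ⟨hdB hi.1, hB'.1.mono_left (Finset.erase_subset _ _)⟩
    refine ⟨j, Finset.mem_sdiff.2 ⟨hjB', hj.2.1⟩, ?_⟩
    rw [if_pos d1, if_pos d2, if_pos hB.1, if_pos hB'.1, ← e1, ← e2]
    exact hle

/-! ### Projective tropical linear spaces -/

/-- The valuated circuits of `μ`: the vectors `C_μ(S)` other than `(∞, …, ∞)`, for `S` an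
`(r + 1)`-subset of the ground set. -/
def ValuatedMatroid.circuits {α : Type*} [DecidableEq α] (μ : ValuatedMatroid α) :
    Set (α → WithTop ℝ) :=
  {C | ∃ S : Finset α, (S : Set α) ⊆ μ.matroid.E ∧ S.card = rank μ.matroid + 1 ∧
    (C = fun i => if i ∈ S then μ.val (S.erase i) else ⊤) ∧ C ≠ fun _ => ⊤}

open Classical in
/-- The tropical linear space `trop(μ)` of a valuated matroid `μ` with ground set `E'`, as a
subset of `ℝ^{E'}/ℝ𝟏`, which is identified with the stratum `T_{E'}` of `ℙ(𝕋^α)`. -/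
def ValuatedMatroid.trop {α : Type*} [DecidableEq α] [Fintype α] (μ : ValuatedMatroid α) :
    Set (TropProj α) :=
  {p | ∃ u : ProjRep α, ⟦u⟧ = p ∧ tsupp u.1 = μ.matroid.E ∧
    ∀ C ∈ μ.circuits, MinAchievedTwice {i | i ∈ tsupp C} fun i => C i + u.1 i}

/-- The projective tropical linear space of `μ`, the union of
`trop(μ/_S) × {∞}^S` over all proper subsets `S` of the ground set. -/
def ValuatedMatroid.projTrop {α : Type*} [DecidableEq α] [Fintype α] (μ : ValuatedMatroid α) :
    Set (TropProj α) :=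
  ⋃ (S : Finset α) (_ : (S : Set α) ⊂ μ.matroid.E), (μ.contract S).trop

/-! ### Point configurations and coherent subdivisions -/

/-- The subconfiguration `Δ_w^u` of a weighted point configuration `(A, a, w)` on which
`⟨u, a_x⟩ + w(x)` is minimal. -/
def coherentFace {A E : Type*} [Fintype E] (a : A → E → ℝ) (w : A → ℝ) (u : E → ℝ) : Set A :=
  {x | ∀ y, u ⬝ᵥ a x + w x ≤ u ⬝ᵥ a y + w y}

/-- The coherent subdivision `Δ_w`, given by its faces. -/
def coherentSubdivision {A E : Type*} [Fintype E] (a : A → E → ℝ) (w : A → ℝ) : Set (Set A) :=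
  range (coherentFace a w)

/-- The Minkowski sum of point configurations. -/
def sumConfig {k : ℕ} {A : Fin k → Type*} {E : Type*} (a : ∀ i, A i → E → ℝ) :
    (∀ i, A i) → E → ℝ :=
  fun x => ∑ i, a i (x i)

/-- The Minkowski sum of weights. -/
def sumWeight {k : ℕ} {A : Fin k → Type*} (w : ∀ i, A i → ℝ) : (∀ i, A i) → ℝ :=
  fun x => ∑ i, w i (x i)

/-- The bases of a matroid. -/
abbrev Bases {α : Type*} (M : Matroid α) : Type _ := {B : Finset α // M.IsBase (B : Set α)}

/-- The point configuration `B ↦ e_B` on the bases of a matroid. -/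
def baseVector {α : Type*} (M : Matroid α) (B : Bases M) : α → ℝ :=
  indicator (B.1 : Set α) 1

/-- The base configuration of a sequence of matroids. -/
def baseConfig {n k : ℕ} (M : Fin k → Matroid (Fin n)) : (∀ i, Bases (M i)) → Fin n → ℝ :=
  sumConfig fun i => baseVector (M i)

/-- The base polytope `Q(M)` of a sequence of matroids. -/
def basePolytope {n k : ℕ} (M : Fin k → Matroid (Fin n)) : Set (Fin n → ℝ) :=
  convexHull ℝ (range (baseConfig M))

/-- A valuated matroid as a real-valued weight on the bases. -/
def ValuatedMatroid.weight {α : Type*} [DecidableEq α] (μ : ValuatedMatroid α)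
    (B : Bases μ.matroid) : ℝ :=
  (μ.val B.1).untop ((μ.val_ne_top_iff B.1).2 B.2)

/-- `μ = (μ₁, …, μ_k)` induces a subdivision of the base polytope of its sequence of underlying
matroids into base polytopes of flag matroids: for each face `F` of the coherent subdivision
given by the Minkowski sum of the weights `μ_i`, the polytope `Conv(F)` is the base polytope of
a flag matroid. -/
def InducesFlagMatroidalSubdivision {n k : ℕ} (μ : Fin k → ValuatedMatroid (Fin n)) : Prop :=
  ∀ F ∈ coherentSubdivision (baseConfig fun i => (μ i).matroid)
      (sumWeight fun i => (μ i).weight),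
    ∃ (l : ℕ) (N : Fin l → Matroid (Fin n)), IsFlagMatroid N ∧
      convexHull ℝ (baseConfig (fun i => (μ i).matroid) '' F) = basePolytope N

end FlagTrop

end

/-!
All conditions are compared with the exchange inequality between pairs of bases `I` of `μ_i` and
`J` of `μ_j`, for `i < j` (`ValuatedExchange`).

For `I' = I \ a` and `J' = J ∪ a`, the terms of the incidence relation of `I', J'` are `P_I P_J` and
the products obtained by exchanging `a`. Hence the incidence relations vanish exactly if exchange
holds (`incidencePlucker_vanishesAt_iff`), and the Grassmann-Plücker relations vanish because each
`μ_i` satisfies the exchange axiom (`grassmannPlucker_vanishesAt`).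

The projective tropical linear space of `μ` consists of the vectors orthogonal to all circuits of
`μ` (`mk_mem_projTrop_iff`). The point is that a vector of a stratum is a tropical sum of cocircuits
(`cocircuitSpanned_of_contract`): a basis of minimal weight that avoids `e` lies in a circuit through
`e`, over which the minimum is achieved a second time, and this gives a basis of minimal weight
through `e`. As exchange between `μ_i` and `μ_j` says that the cocircuits of `μ_i` are orthogonal to
the circuits of `μ_j`, inclusion of the tropical linear spaces implies exchange
(`valuatedExchange_of_circuitOrthogonal`).

The face of the subdivision in direction `u` is the product of the bases of the initial matroids
for the weight `u`. Exchange passes to initial matroids, and between matroids it characterises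
quotients (`IsQuotient.basisExchange`, `BasisExchange.isQuotient`); so exchange gives a subdivision
into base polytopes of flag matroids.

Conversely, given such a subdivision, consider the squared norm of `e_{B_1} + … + e_{B_k}`. It
is at most `∑ min(r_i, r_j)`, with equality exactly for chains of bases. Each face of the base
polytope of a flag matroid contains a point given by a chain, which has the largest norm in the
whole polytope. Therefore the largest norm on the face in direction `u` is locally constant in `u`,
hence constant (`exists_sqNorm_eq_of_coherentFace`). Far away in a generic direction it is the
maximal one, since the underlying matroids form a flag matroid. So for each `u` there is a chain of
bases of minimal weight (`InducesFlagMatroidalSubdivision.exists_nested`), and a small perturbation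
of `u` shows that non-loops of the initial matroids of `μ_i` are non-loops of those of `μ_j`. This is
the inclusion of the tropical linear spaces in the torus; on the boundary the infinite coordinates
are replaced by large real numbers (`CircuitOrthogonal.of_nested`).
-/

namespace FlagTrop

/-! ### Minima that are achieved twice -/

/-- In place of the minimum itself, every finite member of the family is tested. -/
theorem minAchievedTwice_iff {ι : Type*} {s : Finset ι} {f : ι → WithTop ℝ} :
    MinAchievedTwice s f ↔ ∀ v ∈ s, f v ≠ ⊤ → ∃ w ∈ s, w ≠ v ∧ f w ≤ f v := by
  constructor
  · rintro (h | ⟨v, hv, w, hw, hvw, he, hmin⟩) x hx hfx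
    · exact absurd (h x hx) hfx
    · by_cases hxv : x = v
      · exact ⟨w, hw, by rw [hxv]; exact hvw.symm, by rw [hxv, he]⟩
      · exact ⟨v, hv, Ne.symm hxv, hmin x hx⟩
  · intro h
    by_cases htop : ∀ v ∈ s, f v = ⊤
    · exact Or.inl htop
    · push Not at htop
      obtain ⟨x, hx, hfx⟩ := htop
      obtain ⟨v, hv, hmin⟩ := s.exists_min_image f ⟨x, hx⟩
      have hfv : f v ≠ ⊤ := fun h' => hfx (top_le_iff.1 (h' ▸ hmin x hx))
      obtain ⟨w, hw, hwv, hle⟩ := h v hv hfv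
      exact Or.inr ⟨v, hv, w, hw, hwv.symm, le_antisymm (hmin w hw) hle, hmin⟩

/-! ### Exchange and tropical orthogonality to circuits -/

section Exchange

variable {α : Type*} [DecidableEq α]

/-- The exchange inequality that defines valuated matroid quotients, without the conditions on
ground sets and ranks. The exchange axiom of a valuated matroid is the case `μ = ν`. -/
def ValuatedExchange (μ ν : ValuatedMatroid α) : Prop :=
  ∀ I J : Finset α, μ.matroid.IsBase (I : Set α) → ν.matroid.IsBase (J : Set α) →
    ∀ i ∈ I \ J, ∃ j ∈ J \ I,
      μ.val (insert j (I.erase i)) + ν.val (insert i (J.erase j)) ≤ μ.val I + ν.val J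

theorem valuatedExchange_self (μ : ValuatedMatroid α) : ValuatedExchange μ μ := μ.exchange

/-- `u ∈ 𝕋^α` is tropically orthogonal to all valuated circuits of `μ`. The circuit of the set
`B ∪ e` is tested at its entry `μ(B)` in position `e`: some other term is at most as large. All of
`α` is taken as the ground set, so that `e` need not be restricted. -/
def CircuitOrthogonal (μ : ValuatedMatroid α) (u : α → WithTop ℝ) : Prop :=
  ∀ B : Finset α, μ.matroid.IsBase (B : Set α) → ∀ e ∉ B, u e ≠ ⊤ →
    ∃ f ∈ B, μ.val (insert e (B.erase f)) + u f ≤ μ.val B + u e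

/-- `u ∈ 𝕋^α` is the tropical sum of translates of valuated cocircuits `a ↦ μ(K ∪ a)`, `a ∉ K`:
for each `e` in the support, the translate belonging to some `K = J \ e` lies above `u` and
agrees with `u` at `e`. -/
def CocircuitSpanned (μ : ValuatedMatroid α) (u : α → WithTop ℝ) : Prop :=
  ∀ e, u e ≠ ⊤ → ∃ J : Finset α, μ.matroid.IsBase (J : Set α) ∧ e ∈ J ∧
    ∀ a ∉ J, μ.val J + u a ≤ μ.val (insert a (J.erase e)) + u e

theorem ValuatedMatroid.val_ne_top (μ : ValuatedMatroid α) {B : Finset α}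
    (hB : μ.matroid.IsBase (B : Set α)) : μ.val B ≠ ⊤ := (μ.val_ne_top_iff B).2 hB

theorem ne_top_of_add_le {a b c d : WithTop ℝ} (h : a + b ≤ c + d) (hc : c ≠ ⊤) (hd : d ≠ ⊤) :
    a ≠ ⊤ ∧ b ≠ ⊤ := by
  rw [← WithTop.add_ne_top]
  exact ne_top_of_le_ne_top (WithTop.add_ne_top.2 ⟨hc, hd⟩) h

/-- By exchange, a translated cocircuit `a ↦ μ(J \ e ∪ a)` of `μ` satisfies the orthogonality
condition at `e` for the circuits of `ν`; this persists for a vector `u` that lies below it and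
agrees with it at `e`. -/
theorem ValuatedExchange.exists_le_of_cocircuit {μ ν : ValuatedMatroid α}
    (h : ValuatedExchange μ ν) {u : α → WithTop ℝ} {e : α} (hue : u e ≠ ⊤) {J : Finset α}
    (hJ : μ.matroid.IsBase (J : Set α)) (heJ : e ∈ J)
    (hmin : ∀ a ∉ J, μ.val J + u a ≤ μ.val (insert a (J.erase e)) + u e) {B : Finset α}
    (hB : ν.matroid.IsBase (B : Set α)) (heB : e ∉ B) :
    ∃ f ∈ B, ν.val (insert e (B.erase f)) + u f ≤ ν.val B + u e := by
  obtain ⟨j, hj, hle⟩ := h J B hJ hB e (Finset.mem_sdiff.2 ⟨heJ, heB⟩)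
  rw [Finset.mem_sdiff] at hj
  refine ⟨j, hj.1, ?_⟩
  have h1 := hmin j hj.2
  have hJt := μ.val_ne_top hJ
  have hBt := ν.val_ne_top hB
  obtain ⟨h3, h4⟩ := ne_top_of_add_le hle hJt hBt
  obtain ⟨-, h5⟩ := ne_top_of_add_le h1 h3 hue
  lift μ.val J to ℝ using hJt with p
  lift ν.val B to ℝ using hBt with q
  lift μ.val (insert j (J.erase e)) to ℝ using h3 with r
  lift ν.val (insert e (B.erase j)) to ℝ using h4 with s
  lift u j to ℝ using h5 with x
  lift u e to ℝ using hue with y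
  norm_cast at *
  linarith

theorem CocircuitSpanned.circuitOrthogonal {μ ν : ValuatedMatroid α} {u : α → WithTop ℝ}
    (hu : CocircuitSpanned μ u) (h : ValuatedExchange μ ν) : CircuitOrthogonal ν u := by
  intro B hB e heB hue
  obtain ⟨J, hJ, heJ, hmin⟩ := hu e hue
  exact h.exists_le_of_cocircuit hue hJ heJ hmin hB heB

/-- The valuated cocircuit of `μ` for the set `K`. -/
def ValuatedMatroid.cocircuit (μ : ValuatedMatroid α) (K : Finset α) (a : α) : WithTop ℝ :=
  if a ∈ K then ⊤ else μ.val (insert a K)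

theorem ValuatedMatroid.cocircuitSpanned_cocircuit (μ : ValuatedMatroid α) (K : Finset α) :
    CocircuitSpanned μ (μ.cocircuit K) := by
  intro e he
  have heK : e ∉ K := fun h => he (by simp [cocircuit, h])
  rw [cocircuit, if_neg heK] at he
  refine ⟨insert e K, (μ.val_ne_top_iff _).1 he, Finset.mem_insert_self _ _, fun a ha => ?_⟩
  have haK : a ∉ K := fun h => ha (Finset.mem_insert_of_mem h)
  rw [cocircuit, cocircuit, if_neg haK, if_neg heK, Finset.erase_insert heK, add_comm]

/-- Exchange is orthogonality of the cocircuits of `μ` to the circuits of `ν`. -/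
theorem valuatedExchange_of_circuitOrthogonal {μ ν : ValuatedMatroid α}
    (h : ∀ u : α → WithTop ℝ, u ≠ (fun _ => ⊤) → CircuitOrthogonal μ u → CircuitOrthogonal ν u) :
    ValuatedExchange μ ν := by
  intro I J hI hJ i hi
  rw [Finset.mem_sdiff] at hi
  have hui : μ.cocircuit (I.erase i) i = μ.val I := by
    rw [ValuatedMatroid.cocircuit, if_neg (Finset.notMem_erase _ _), Finset.insert_erase hi.1]
  have huit : μ.cocircuit (I.erase i) i ≠ ⊤ := by rw [hui]; exact μ.val_ne_top hI
  obtain ⟨f, hf, hle⟩ := h (μ.cocircuit (I.erase i)) (fun h0 => huit (congrFun h0 i))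
    ((μ.cocircuitSpanned_cocircuit _).circuitOrthogonal (valuatedExchange_self μ)) J hJ i hi.2 huit
  have hft := (ne_top_of_add_le hle (ν.val_ne_top hJ) huit).2
  have hfI' : f ∉ I.erase i := fun h' => hft (by simp only [ValuatedMatroid.cocircuit, if_pos h'])
  have hfi : f ≠ i := fun h' => hi.2 (h' ▸ hf)
  have hfI : f ∉ I := fun h' => hfI' (Finset.mem_erase.2 ⟨hfi, h'⟩)
  refine ⟨f, Finset.mem_sdiff.2 ⟨hf, hfI⟩, ?_⟩
  rw [hui, ValuatedMatroid.cocircuit, if_neg hfI'] at hle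
  rw [add_comm, add_comm (μ.val I)]
  exact hle

theorem CircuitOrthogonal.add_const {μ : ValuatedMatroid α} {u v : α → WithTop ℝ} {c : ℝ}
    (hc : ∀ i, v i = u i + (c : WithTop ℝ)) (hu : CircuitOrthogonal μ u) :
    CircuitOrthogonal μ v := by
  intro B hB e heB hve
  have hue : u e ≠ ⊤ := fun h => hve (by rw [hc, h, WithTop.top_add])
  obtain ⟨f, hf, hle⟩ := hu B hB e heB hue
  refine ⟨f, hf, ?_⟩
  rw [hc, hc, ← add_assoc, ← add_assoc]
  gcongr

/-- `B` is a basis of the initial matroid of `μ` for the real weight vector `u`. -/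
def ValuatedMatroid.IsMinimizer (μ : ValuatedMatroid α) (u : α → ℝ) (B : Finset α) : Prop :=
  μ.matroid.IsBase (B : Set α) ∧
    ∀ B' : Finset α, μ.val B + (∑ e ∈ B, u e : ℝ) ≤ μ.val B' + (∑ e ∈ B', u e : ℝ)

theorem ValuatedMatroid.exists_isMinimizer [Finite α] (μ : ValuatedMatroid α) (u : α → ℝ) :
    ∃ B : Finset α, μ.IsMinimizer u B := by
  have := Fintype.ofFinite α
  obtain ⟨B, -, hB⟩ := (Finset.univ : Finset (Finset α)).exists_min_image
    (fun B => μ.val B + (∑ e ∈ B, u e : ℝ)) ⟨∅, Finset.mem_univ _⟩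
  refine ⟨B, (μ.val_ne_top_iff B).1 fun h => ?_, fun B' => hB B' (Finset.mem_univ _)⟩
  obtain ⟨B₀, hB₀⟩ := exists_finset_isBase μ.matroid
  have := hB B₀ (Finset.mem_univ _)
  simp only [h, WithTop.top_add, top_le_iff] at this
  exact μ.val_ne_top hB₀ (by simpa using this)

theorem sum_insert_erase {Γ : Type*} [AddCommGroup Γ] {u : α → Γ} {B : Finset α} {e f : α}
    (he : e ∉ B) (hf : f ∈ B) :
    ∑ a ∈ insert e (B.erase f), u a = ∑ a ∈ B, u a + u e - u f := by
  rw [Finset.sum_insert (fun h => he (Finset.mem_of_mem_erase h)), ← Finset.add_sum_erase _ _ hf]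
  abel

/-- The initial matroid of `μ` for the weight `-x` does not have the loop `e`, if at a basis of it
that avoids `e` the minimum over the circuit of `B ∪ e` is achieved twice. -/
theorem ValuatedMatroid.exists_isMinimizer_mem [Finite α] (μ : ValuatedMatroid α) (x : α → ℝ)
    (e : α) (h : ∀ B, μ.IsMinimizer (-x) B → e ∉ B →
      ∃ f ∈ B, μ.val (insert e (B.erase f)) + x f ≤ μ.val B + x e) :
    ∃ B, μ.IsMinimizer (-x) B ∧ e ∈ B := by
  obtain ⟨B, hB⟩ := μ.exists_isMinimizer (-x)
  by_cases heB : e ∈ B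
  · exact ⟨B, hB, heB⟩
  obtain ⟨f, hf, hle⟩ := h B hB heB
  have ht := (ne_top_of_add_le hle (μ.val_ne_top hB.1) WithTop.coe_ne_top).1
  refine ⟨insert e (B.erase f), ⟨(μ.val_ne_top_iff _).1 ht, fun B' => le_trans ?_ (hB.2 B')⟩,
    Finset.mem_insert_self _ _⟩
  rw [sum_insert_erase heB hf]
  have hBt := μ.val_ne_top hB.1
  lift μ.val B to ℝ using hBt with p
  lift μ.val (insert e (B.erase f)) to ℝ using ht with q
  norm_cast at *
  simp only [Pi.neg_apply]
  linarith

/-- A basis of the initial matroid for the weight `-x` gives cocircuits lying above `x`. -/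
theorem ValuatedMatroid.IsMinimizer.val_add_le {μ : ValuatedMatroid α} {x : α → ℝ} {B : Finset α}
    (hB : μ.IsMinimizer (-x) B) {e a : α} (he : e ∈ B) (ha : a ∉ B) :
    μ.val B + x a ≤ μ.val (insert a (B.erase e)) + x e := by
  have h := hB.2 (insert a (B.erase e))
  rw [sum_insert_erase ha he] at h
  have hBt := μ.val_ne_top hB.1
  by_cases ht : μ.val (insert a (B.erase e)) = ⊤
  · simp [ht]
  lift μ.val B to ℝ using hBt with p
  lift μ.val (insert a (B.erase e)) to ℝ using ht with q
  norm_cast at *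
  simp only [Pi.neg_apply] at h
  linarith

end Exchange

/-! ### Projective tropical linear spaces as orthogonal complements of circuits -/

theorem circuitOrthogonal_congr {α : Type*} [DecidableEq α] {μ : ValuatedMatroid α} {u v : ProjRep α} (h : u ≈ v) :
    CircuitOrthogonal μ u.1 ↔ CircuitOrthogonal μ v.1 := by
  obtain ⟨c, hc⟩ := h
  obtain ⟨d, hd⟩ := (projSetoid α).symm (⟨c, hc⟩ : u ≈ v)
  exact ⟨fun hu => hu.add_const hc, fun hv => hv.add_const hd⟩

section ProjTrop

variable {α : Type*} [DecidableEq α] [Fintype α]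

theorem ValuatedMatroid.contract_isBase (μ : ValuatedMatroid α) {S B : Finset α} :
    (μ.contract S).matroid.IsBase (B : Set α) ↔
      Disjoint B S ∧ μ.matroid.IsBase ((B ∪ chosenBasis μ.matroid S : Finset α) : Set α) := by
  rw [Finset.coe_union, ← Finset.disjoint_coe]
  exact contract_isBase_iff' (chosenBasis_spec μ.matroid S)

theorem ValuatedMatroid.contract_val (μ : ValuatedMatroid α) {S B : Finset α}
    (h : Disjoint B S) : (μ.contract S).val B = μ.val (B ∪ chosenBasis μ.matroid S) :=
  if_pos h

/-- A member of the stratum of `trop(μ/S)` is a tropical sum of cocircuits of `μ/S`, hence of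
`μ`. -/
theorem cocircuitSpanned_of_contract {μ : ValuatedMatroid α} {S : Finset α} {u : α → WithTop ℝ}
    (hsupp : ∀ a, u a = ⊤ ↔ a ∈ S) (hE : μ.matroid.E = univ)
    (hC : ∀ C ∈ (μ.contract S).circuits,
      open Classical in MinAchievedTwice {i | i ∈ tsupp C} fun i => C i + u i) :
    CocircuitSpanned μ u := by
  classical
  intro e hue
  have heS : e ∉ S := fun h => hue ((hsupp e).2 h)
  set I := chosenBasis μ.matroid S with hI
  have hIspec := chosenBasis_spec μ.matroid S
  rw [← hI] at hIspec
  have hIS : I ⊆ S := by exact_mod_cast hIspec.subset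
  have hux : ∀ a ∉ S, u a = ((u a).untopD 0 : ℝ) := fun a ha => by
    have : u a ≠ ⊤ := fun h => ha ((hsupp a).1 h)
    lift u a to ℝ using this with r
    simp
  have hmem := (μ.contract S).exists_isMinimizer_mem (fun a => (u a).untopD 0) e ?_
  · obtain ⟨B, hB, heB⟩ := hmem
    obtain ⟨hd, hBI⟩ := μ.contract_isBase.1 hB.1
    rw [← hI] at hBI
    have heI : e ∉ I := fun h => heS (hIS h)
    refine ⟨B ∪ I, hBI, Finset.mem_union_left _ heB, fun a ha => ?_⟩
    rw [Finset.mem_union, not_or] at ha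
    by_cases haS : a ∈ S
    · -- `I ∪ a` is dependent, so that the cocircuit is infinite at `a`
      suffices h : μ.val (insert a ((B ∪ I).erase e)) = ⊤ by simp [h]
      by_contra h
      have hind := ((μ.val_ne_top_iff _).1 h).indep.subset (I := insert a (I : Set α)) (by
        intro b hb
        rcases hb with rfl | hb
        · simp
        · have : b ≠ e := fun h => heI (h ▸ hb)
          exact Finset.mem_coe.2 (Finset.mem_insert_of_mem
            (Finset.mem_erase.2 ⟨this, Finset.mem_union_right _ hb⟩)))
      exact ha.2 (by exact_mod_cast hIspec.mem_of_insert_indep (by exact_mod_cast haS) hind)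
    · have h1 := hB.val_add_le heB ha.1
      have hd' : Disjoint (insert a (B.erase e)) S :=
        Finset.disjoint_insert_left.2 ⟨haS, hd.mono_left (Finset.erase_subset _ _)⟩
      rw [μ.contract_val hd, μ.contract_val hd', ← hux a haS, ← hux e heS, ← hI,
        Finset.insert_union] at h1
      rwa [Finset.erase_union_distrib, Finset.erase_eq_of_notMem heI]
  · intro B hB heB
    obtain ⟨hd, hBI⟩ := μ.contract_isBase.1 hB.1
    have hBt := (μ.contract S).val_ne_top hB.1
    set C : α → WithTop ℝ :=
      fun i => if i ∈ insert e B then (μ.contract S).val ((insert e B).erase i) else ⊤ with hCdef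
    have hCe : C e = (μ.contract S).val B := by simp [hCdef, Finset.erase_insert heB]
    have hCmem : C ∈ (μ.contract S).circuits := by
      refine ⟨insert e B, ?_, ?_, rfl, fun h => hBt (by rw [← hCe, h])⟩
      · intro a ha
        change a ∈ μ.matroid.E \ (S : Set α)
        rw [hE]
        refine ⟨mem_univ _, fun haS => ?_⟩
        rcases Finset.mem_insert.1 (Finset.mem_coe.1 ha) with rfl | h
        · exact heS haS
        · exact Finset.disjoint_left.1 hd h haS
      · rw [Finset.card_insert_of_notMem heB, card_eq_rank hB.1]
    obtain ⟨f, hf, hfe, hle⟩ := minAchievedTwice_iff.1 (hC C hCmem) e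
      (Finset.mem_filter.2 ⟨Finset.mem_univ _, hCe.trans_ne hBt⟩) (by rw [hCe]; exact WithTop.add_ne_top.2 ⟨hBt, hue⟩)
    have hfC : C f ≠ ⊤ := (Finset.mem_filter.1 hf).2
    have hf' : f ∈ insert e B := by
      by_contra h
      exact hfC (by simp only [hCdef, if_neg h])
    have hfB : f ∈ B := (Finset.mem_insert.1 hf').resolve_left hfe
    refine ⟨f, hfB, ?_⟩
    rw [hCe] at hle
    simp only [hCdef, if_pos hf'] at hle
    rw [Finset.erase_insert_of_ne hfe.symm] at hle
    rwa [← hux e heS, ← hux f (Finset.disjoint_left.1 hd hfB)]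

theorem CircuitOrthogonal.contract {μ : ValuatedMatroid α} {S : Finset α} {u : α → WithTop ℝ}
    (hsupp : ∀ a, u a = ⊤ ↔ a ∈ S) (hu : CircuitOrthogonal μ u) :
    ∀ C ∈ (μ.contract S).circuits,
      open Classical in MinAchievedTwice {i | i ∈ tsupp C} fun i => C i + u i := by
  rintro C ⟨T, -, -, rfl, -⟩
  rw [minAchievedTwice_iff]
  intro v hv hvt
  rw [WithTop.add_ne_top] at hvt
  obtain ⟨hCv, huv⟩ := hvt
  have hvT : v ∈ T := by
    by_contra h
    exact hCv (by simp only [if_neg h])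
  simp only [if_pos hvT] at hCv ⊢
  have hbase := ((μ.contract S).val_ne_top_iff _).1 hCv
  obtain ⟨hd, hBI⟩ := μ.contract_isBase.1 hbase
  set I := chosenBasis μ.matroid S with hI
  have hIS : I ⊆ S := by exact_mod_cast (chosenBasis_spec μ.matroid S).subset
  have hvS : v ∉ S := fun h => huv ((hsupp v).2 h)
  have hvB : v ∉ T.erase v ∪ I := by
    simp only [Finset.mem_union, Finset.notMem_erase, false_or]
    exact fun h => hvS (hIS h)
  obtain ⟨f, hf, hle⟩ := hu _ hBI v hvB huv
  rw [← μ.contract_val hd] at hle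
  obtain ⟨h1, h2⟩ := ne_top_of_add_le hle hCv huv
  have hfS : f ∉ S := fun h => h2 ((hsupp f).2 h)
  have hfI : f ∉ I := fun h => hfS (hIS h)
  obtain ⟨hfv, hfT⟩ := Finset.mem_erase.1 ((Finset.mem_union.1 hf).resolve_right hfI)
  have hd' : Disjoint (T.erase f) S := by
    rw [Finset.disjoint_left] at hd ⊢
    intro a ha haS
    by_cases hav : a = v
    · exact hvS (hav ▸ haS)
    · exact hd (Finset.mem_erase.2 ⟨hav, Finset.mem_of_mem_erase ha⟩) haS
  have hset : insert v ((T.erase v ∪ I).erase f) = T.erase f ∪ I := by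
    rw [Finset.erase_union_distrib, Finset.erase_eq_of_notMem hfI, ← Finset.insert_union,
      Finset.erase_right_comm,
      Finset.insert_erase (Finset.mem_erase.2 ⟨hfv.symm, hvT⟩)]
  rw [hset, ← μ.contract_val hd'] at hle
  refine ⟨f, ?_, hfv, ?_⟩
  · rw [hset, ← μ.contract_val hd'] at h1
    simp [tsupp, hfT, h1]
  · simpa only [if_pos hfT] using hle

theorem mk_mem_projTrop_iff {μ : ValuatedMatroid α} (hE : μ.matroid.E = univ) (u : ProjRep α) :
    (⟦u⟧ : TropProj α) ∈ μ.projTrop ↔ CircuitOrthogonal μ u.1 := by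
  have hground : ∀ S : Finset α, (μ.contract S).matroid.E = (S : Set α)ᶜ := fun S => by
    change μ.matroid.E \ (S : Set α) = _
    rw [hE, compl_eq_univ_sdiff]
  simp only [ValuatedMatroid.projTrop, mem_iUnion, ValuatedMatroid.trop, mem_ofPred_eq, hground]
  constructor
  · rintro ⟨S, -, v, hv, hsupp, hC⟩
    rw [← circuitOrthogonal_congr (Quotient.exact hv)]
    refine (cocircuitSpanned_of_contract (S := S) (fun a => ?_) hE hC).circuitOrthogonal
      (valuatedExchange_self μ)
    have := Set.ext_iff.1 hsupp a
    simp only [tsupp, mem_ofPred_eq, mem_compl_iff, Finset.mem_coe] at this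
    tauto
  · intro hu
    classical
    refine ⟨({a | u.1 a = ⊤} : Finset α), ?_, u, rfl, ?_, hu.contract (by simp)⟩
    · rw [hE, ssubset_univ_iff]
      intro h
      exact u.2 (funext fun a => by
        have : a ∈ ((({a | u.1 a = ⊤} : Finset α)) : Set α) := h ▸ mem_univ a
        simpa using this)
    · ext a
      simp [tsupp]

theorem projTrop_subset_iff {μ ν : ValuatedMatroid α} (hμ : μ.matroid.E = univ)
    (hν : ν.matroid.E = univ) : μ.projTrop ⊆ ν.projTrop ↔
      ∀ u : α → WithTop ℝ, u ≠ (fun _ => ⊤) → CircuitOrthogonal μ u → CircuitOrthogonal ν u := by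
  constructor
  · intro h u hu hμu
    exact (mk_mem_projTrop_iff hν ⟨u, hu⟩).1 (h ((mk_mem_projTrop_iff hμ ⟨u, hu⟩).2 hμu))
  · intro h p
    induction p using Quotient.inductionOn with
    | h u =>
      rw [mk_mem_projTrop_iff hμ, mk_mem_projTrop_iff hν]
      exact h u.1 u.2

end ProjTrop

/-! ### Quadratic tropical relations and the flag Dressian -/

theorem term_single_add_single {V : Type*} (F : TropPoly V) (u : V → WithTop ℝ) (v : F.support)
    {x y : V} (hv : v.1 = Finsupp.single x 1 + Finsupp.single y 1) :
    F.term u v = (F.coeff v : WithTop ℝ) + (u x + u y) := by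
  rw [TropPoly.term, hv, Finsupp.sum_add_index' (by simp) (by intros; rw [add_smul]),
    Finsupp.sum_single_index (by simp), Finsupp.sum_single_index (by simp), one_smul, one_smul]

theorem quadPoly_vanishesAt_iff {V : Type*} {T : Finset (V × V)} {u : V → WithTop ℝ} :
    (quadPoly T).VanishesAt u ↔ ∀ t ∈ T, u t.1 + u t.2 ≠ ⊤ → ∃ s ∈ T,
      Finsupp.single s.1 1 + Finsupp.single s.2 1 ≠
        (Finsupp.single t.1 1 + Finsupp.single t.2 1 : V →₀ ℕ) ∧
      u s.1 + u s.2 ≤ u t.1 + u t.2 := by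
  classical
  rw [TropPoly.VanishesAt, minAchievedTwice_iff]
  have hterm : ∀ (v : (quadPoly T).support) (x y : V),
      v.1 = Finsupp.single x 1 + Finsupp.single y 1 → (quadPoly T).term u v = u x + u y := by
    intro v x y h
    rw [term_single_add_single _ _ _ h]
    simp [quadPoly]
  have hmem : ∀ v : V →₀ ℕ, v ∈ (quadPoly T).support ↔
      ∃ t ∈ T, Finsupp.single t.1 1 + Finsupp.single t.2 1 = v := by
    intro v
    simp only [quadPoly, Finset.mem_image]
  constructor
  · intro h t ht htop
    obtain ⟨w, -, hwv, hle⟩ := h ⟨_, (hmem _).2 ⟨t, ht, rfl⟩⟩ (Finset.mem_univ _)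
      (by rwa [hterm _ _ _ rfl])
    obtain ⟨s, hs, hsw⟩ := (hmem _).1 w.2
    refine ⟨s, hs, fun h' => hwv (Subtype.ext (hsw.symm.trans h')), ?_⟩
    rwa [hterm w _ _ hsw.symm, hterm _ _ _ rfl] at hle
  · intro h v _ hv
    obtain ⟨t, ht, htv⟩ := (hmem _).1 v.2
    rw [hterm v _ _ htv.symm] at hv ⊢
    obtain ⟨s, hs, hne, hle⟩ := h t ht hv
    refine ⟨⟨_, (hmem _).2 ⟨s, hs, rfl⟩⟩, Finset.mem_univ _,
      fun h' => hne (by rw [htv, ← h']), ?_⟩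
    rwa [hterm _ _ _ rfl]

theorem single_add_single_ne {V : Type*} {x y x' y' : V} (h : x ≠ x') (h' : x ≠ y') :
    (Finsupp.single x' 1 + Finsupp.single y' 1 : V →₀ ℕ) ≠
      Finsupp.single x 1 + Finsupp.single y 1 := by
  intro heq
  have := DFunLike.congr_fun heq x
  simp only [Finsupp.add_apply, Finsupp.single_eq_same, Finsupp.single_eq_of_ne h,
    Finsupp.single_eq_of_ne h'] at this
  omega

section FlagDressian

variable {n k : ℕ}

/-- The Plücker coordinates of a sequence of valuated matroids. -/
def pluckerVector (μ : Fin k → ValuatedMatroid (Fin n))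
    (x : FlagVar n fun i => rank (μ i).matroid) : WithTop ℝ :=
  (μ x.1).val x.2.1

/-- By symmetry of the exchange axiom, every term of a Grassmann-Plücker relation of a valuated
matroid is matched by another one. -/
theorem grassmannPlucker_vanishesAt (μ : Fin k → ValuatedMatroid (Fin n)) (i : Fin k)
    {F : TropPoly (FlagVar n fun i => rank (μ i).matroid)}
    (hF : F ∈ grassmannPlucker n (fun i => rank (μ i).matroid) i) :
    F.VanishesAt (pluckerVector μ) := by
  classical
  obtain ⟨I, J, a, ha, hcard, rfl⟩ := hF
  rw [Finset.mem_sdiff] at ha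
  obtain ⟨haI, haJ⟩ := ha
  rw [quadPoly_vanishesAt_iff]
  set r := rank (μ i).matroid with hr
  have hIJ : ∀ j, I.1 ≠ insert a (J.1.erase j) := by
    intro j h
    have hsub : I.1.erase a ⊆ I.1 ∩ J.1 := by
      intro b hb
      obtain ⟨hba, hbI⟩ := Finset.mem_erase.1 hb
      rw [Finset.mem_inter]
      refine ⟨hbI, ?_⟩
      rw [h] at hbI
      exact Finset.mem_of_mem_erase ((Finset.mem_insert.1 hbI).resolve_left hba)
    have h1 := Finset.card_le_card hsub
    have h2 := Finset.card_erase_add_one haI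
    have h3 := I.2
    simp only at h3 hcard
    omega
  -- the exchanged pairs as members of the relation
  have hsw : ∀ j ∈ J.1 \ I.1, ∃ s : RSubset n r × RSubset n r,
      s.1.1 = insert j (I.1.erase a) ∧ s.2.1 = insert a (J.1.erase j) := by
    intro j hj
    rw [Finset.mem_sdiff] at hj
    refine ⟨⟨⟨_, ?_⟩, ⟨_, ?_⟩⟩, rfl, rfl⟩
    · rw [Finset.card_insert_of_notMem (fun h => hj.2 (Finset.mem_of_mem_erase h)),
        Finset.card_erase_add_one haI, I.2]
    · rw [Finset.card_insert_of_notMem (fun h => haJ (Finset.mem_of_mem_erase h)),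
        Finset.card_erase_add_one hj.1, J.2]
  have hvar : ∀ K L : RSubset n r, K.1 ≠ L.1 →
      (⟨i, K⟩ : FlagVar n fun i => rank (μ i).matroid) ≠ ⟨i, L⟩ := by
    rintro K L h h'
    cases h'
    exact h rfl
  intro t ht htop
  obtain ⟨⟨K, L⟩, hKL, rfl⟩ := Finset.mem_image.1 ht
  simp only [pluckerVector] at htop ⊢
  rw [WithTop.add_ne_top, (μ i).val_ne_top_iff, (μ i).val_ne_top_iff] at htop
  rcases (Finset.mem_filter.1 hKL).2 with h | ⟨j, hj, hK, hL⟩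
  · obtain ⟨rfl, rfl⟩ := Prod.mk.inj h
    obtain ⟨j, hj, hle⟩ := (μ i).exchange _ _ htop.1 htop.2 a (Finset.mem_sdiff.2 ⟨haI, haJ⟩)
    obtain ⟨s, hs1, hs2⟩ := hsw j hj
    refine ⟨(⟨i, s.1⟩, ⟨i, s.2⟩), Finset.mem_image.2 ⟨s, Finset.mem_filter.2
      ⟨Finset.mem_univ _, Or.inr ⟨j, hj, hs1, hs2⟩⟩, rfl⟩, ?_, ?_⟩
    · refine single_add_single_ne (hvar _ _ ?_) (hvar _ _ ?_)
      · rw [hs1]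
        intro h
        have := h ▸ haI
        rw [Finset.mem_sdiff] at hj
        simp only [Finset.mem_insert, Finset.notMem_erase, or_false] at this
        exact haJ (this ▸ hj.1)
      · rw [hs2]
        exact hIJ j
    · simp only [hs1, hs2]
      exact hle
  · simp only at hK hL
    have hjIJ := Finset.mem_sdiff.1 hj
    have haj : a ≠ j := fun h => haJ (h ▸ hjIJ.1)
    have haK : a ∉ K.1 := by rw [hK]; simp [haj]
    have hjK : j ∈ K.1 \ L.1 := by
      rw [hK, hL]
      simp [haj.symm]
    obtain ⟨b, hb, hle⟩ := (μ i).exchange _ _ htop.1 htop.2 j hjK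
    rw [Finset.mem_sdiff] at hb
    by_cases hba : b = a
    · subst hba
      refine ⟨(⟨i, I⟩, ⟨i, J⟩), Finset.mem_image.2 ⟨(I, J), Finset.mem_filter.2
        ⟨Finset.mem_univ _, Or.inl rfl⟩, rfl⟩, (single_add_single_ne (hvar _ _ ?_)
          (hvar _ _ ?_)).symm, ?_⟩
      · exact fun h => haK (h ▸ haI)
      · rw [hL]
        exact hIJ j
      · have e1 : insert b (K.1.erase j) = I.1 := by
          rw [hK, Finset.erase_insert (fun h => hjIJ.2 (Finset.mem_of_mem_erase h)),
            Finset.insert_erase haI]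
        have e2 : insert j (L.1.erase b) = J.1 := by
          rw [hL, Finset.erase_insert (fun h => haJ (Finset.mem_of_mem_erase h)),
            Finset.insert_erase hjIJ.1]
        rwa [e1, e2] at hle
    · have hbJ : b ∈ J.1 ∧ b ≠ j := by
        have := hb.1
        rw [hL] at this
        simp only [Finset.mem_insert, hba, Finset.mem_erase, false_or] at this
        exact this.symm
      have hbI : b ∉ I.1 := by
        have := hb.2
        rw [hK] at this
        simp only [Finset.mem_insert, Finset.mem_erase, hbJ.2, ne_eq, hba, not_false_eq_true,
          true_and, false_or] at this
        exact this
      obtain ⟨s, hs1, hs2⟩ := hsw b (Finset.mem_sdiff.2 ⟨hbJ.1, hbI⟩)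
      refine ⟨(⟨i, s.1⟩, ⟨i, s.2⟩), Finset.mem_image.2 ⟨s, Finset.mem_filter.2
        ⟨Finset.mem_univ _, Or.inr ⟨b, Finset.mem_sdiff.2 ⟨hbJ.1, hbI⟩, hs1, hs2⟩⟩, rfl⟩,
          (single_add_single_ne (hvar _ _ ?_) (hvar _ _ ?_)), ?_⟩
      · rw [hs1, hK]
        intro h
        have : j ∈ insert b (I.1.erase a) := h ▸ Finset.mem_insert_self _ _
        simp [hbJ.2.symm, hjIJ.2] at this
      · intro h
        exact haK (h ▸ hs2 ▸ Finset.mem_insert_self _ _)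
      · have e1 : insert b (K.1.erase j) = s.1.1 := by
          rw [hK, hs1, Finset.erase_insert (fun h => hjIJ.2 (Finset.mem_of_mem_erase h))]
        have e2 : insert j (L.1.erase b) = s.2.1 := by
          rw [hL, hs2, Finset.erase_insert_of_ne (Ne.symm hba), Finset.insert_comm,
            Finset.erase_right_comm, Finset.insert_erase (Finset.mem_erase.2 ⟨hbJ.2.symm, hjIJ.1⟩)]
        rwa [e1, e2] at hle

/-- With `I' = I \ a` and `J' = J ∪ a`, the incidence relations say that each pair of bases
`I, J` and each `a ∈ I \ J` admit an exchange. -/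
theorem incidencePlucker_vanishesAt_iff (μ : Fin k → ValuatedMatroid (Fin n)) {i j : Fin k}
    (hij : i ≠ j) :
    (∀ F ∈ incidencePlucker n (fun i => rank (μ i).matroid) i j,
      F.VanishesAt (pluckerVector μ)) ↔ ValuatedExchange (μ i) (μ j) := by
  classical
  constructor
  · intro h I J hI hJ a ha
    have ha' := ha
    rw [Finset.mem_sdiff] at ha'
    have hcI : (I.erase a).card + 1 = rank (μ i).matroid := by
      rw [Finset.card_erase_add_one ha'.1, card_eq_rank hI]
    have hcJ : (insert a J).card = rank (μ j).matroid + 1 := by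
      rw [Finset.card_insert_of_notMem ha'.2, card_eq_rank hJ]
    have hF := h _ ⟨I.erase a, insert a J, hcI, hcJ, rfl⟩
    rw [quadPoly_vanishesAt_iff] at hF
    obtain ⟨s, hs, hne, hle⟩ := hF (⟨i, I, card_eq_rank hI⟩, ⟨j, J, card_eq_rank hJ⟩)
      (Finset.mem_image.2 ⟨(⟨I, card_eq_rank hI⟩, ⟨J, card_eq_rank hJ⟩), Finset.mem_filter.2
        ⟨Finset.mem_univ _, a, by simp, by simp [Finset.insert_erase ha'.1],
          by simp [Finset.erase_insert ha'.2]⟩, rfl⟩)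
      (WithTop.add_ne_top.2 ⟨(μ i).val_ne_top hI, (μ j).val_ne_top hJ⟩)
    obtain ⟨⟨⟨K, hKc⟩, ⟨L, hLc⟩⟩, hKL, rfl⟩ := Finset.mem_image.1 hs
    obtain ⟨b, hb, hK, hL⟩ := (Finset.mem_filter.1 hKL).2
    simp only at hK hL
    have hba : b ≠ a := by
      rintro rfl
      rw [Finset.insert_erase ha'.1] at hK
      rw [Finset.erase_insert ha'.2] at hL
      subst hK hL
      exact hne rfl
    rw [Finset.mem_sdiff] at hb
    refine ⟨b, Finset.mem_sdiff.2 ⟨(Finset.mem_insert.1 hb.1).resolve_left hba,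
      fun h' => hb.2 (Finset.mem_erase.2 ⟨hba, h'⟩)⟩, ?_⟩
    simp only [pluckerVector] at hle
    rwa [hK, hL, Finset.erase_insert_of_ne hba.symm] at hle
  · rintro h F ⟨I', J', hcI, hcJ, rfl⟩
    simp only at hcI hcJ
    rw [quadPoly_vanishesAt_iff]
    intro t ht htop
    obtain ⟨⟨⟨I, hIc⟩, ⟨J, hJc⟩⟩, hIJ, rfl⟩ := Finset.mem_image.1 ht
    obtain ⟨a, ha, hI, hJ⟩ := (Finset.mem_filter.1 hIJ).2
    simp only [pluckerVector] at hI hJ htop ⊢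
    rw [WithTop.add_ne_top, (μ i).val_ne_top_iff, (μ j).val_ne_top_iff] at htop
    rw [Finset.mem_sdiff] at ha
    have haIJ : a ∈ I \ J := by rw [hI, hJ]; simp
    obtain ⟨b, hb, hle⟩ := h I J htop.1 htop.2 a haIJ
    rw [Finset.mem_sdiff] at hb
    have hbJ' : b ∈ J' ∧ b ≠ a := by
      have := hb.1
      rw [hJ] at this
      exact (Finset.mem_erase.1 this).symm
    have hbI' : b ∉ I' := by
      have := hb.2
      rw [hI] at this
      exact fun h => this (Finset.mem_insert_of_mem h)
    have e1 : insert b (I.erase a) = insert b I' := by rw [hI, Finset.erase_insert ha.2]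
    have e2 : insert a (J.erase b) = J'.erase b := by
      rw [hJ, Finset.erase_right_comm, Finset.insert_erase]
      exact Finset.mem_erase.2 ⟨hbJ'.2.symm, ha.1⟩
    rw [e1, e2] at hle
    refine ⟨(⟨i, insert b I', by rw [Finset.card_insert_of_notMem hbI', hcI]⟩,
      ⟨j, J'.erase b, by have := Finset.card_erase_add_one hbJ'.1; simp only; omega⟩),
      Finset.mem_image.2 ⟨(⟨_, _⟩, ⟨_, _⟩), Finset.mem_filter.2 ⟨Finset.mem_univ _, b,
        Finset.mem_sdiff.2 ⟨hbJ'.1, hbI'⟩, rfl, rfl⟩, rfl⟩,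
      single_add_single_ne ?_ ?_, hle⟩
    · intro h'
      have h'' : I = insert b I' := by
        have := eq_of_heq (Sigma.mk.inj h').2
        exact congrArg Subtype.val this
      rw [hI] at h''
      have : b ∈ insert a I' := h'' ▸ Finset.mem_insert_self _ _
      exact (Finset.mem_insert.1 this).elim hbJ'.2 hbI'
    · exact fun h' => hij (congrArg Sigma.fst h')

/-- Vanishing of a relation that is homogeneous in two groups of variables does not depend on the
chosen representatives. -/
theorem quadPoly_vanishesAt_congr {V : Type*} {T : Finset (V × V)} {u v : V → WithTop ℝ}
    {c : ℝ} (hT : ∀ t ∈ T, v t.1 + v t.2 = u t.1 + u t.2 + (c : WithTop ℝ))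
    (hv : (quadPoly T).VanishesAt v) : (quadPoly T).VanishesAt u := by
  rw [quadPoly_vanishesAt_iff] at hv ⊢
  intro t ht htop
  obtain ⟨s, hs, hne, hle⟩ := hv t ht (by
    rw [hT t ht]
    exact WithTop.add_ne_top.2 ⟨htop, WithTop.coe_ne_top⟩)
  rw [hT t ht, hT s hs] at hle
  exact ⟨s, hs, hne, WithTop.le_of_add_le_add_right WithTop.coe_ne_top hle⟩

theorem toProj_mem_flagDressianOf_iff (μ : Fin k → ValuatedMatroid (Fin n)) :
    ((fun i => (μ i).toProj) ∈ flagDressianOf fun i => (μ i).matroid) ↔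
      ∀ i j, i < j → ValuatedExchange (μ i) (μ j) := by
  classical
  constructor
  · rintro ⟨h, -⟩ i j hij
    rw [← incidencePlucker_vanishesAt_iff μ hij.ne]
    intro F hF
    obtain ⟨u, hu, hFu⟩ := mem_iInter₂.1 h F
      (Or.inr (mem_iUnion.2 ⟨i, mem_iUnion.2 ⟨j, mem_iUnion.2 ⟨hij, hF⟩⟩⟩))
    choose c hc using fun i => Quotient.exact (hu i).symm
    obtain ⟨I', J', -, -, rfl⟩ := hF
    refine quadPoly_vanishesAt_congr (c := c i + c j) (fun t ht => ?_) hFu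
    obtain ⟨⟨I, J⟩, -, rfl⟩ := Finset.mem_image.1 ht
    simp only [pluckerVector, hc]
    rw [WithTop.coe_add, add_add_add_comm]
  · intro h
    refine ⟨mem_iInter₂.2 fun F hF => ⟨_, fun i => rfl, ?_⟩, fun i => ⟨_, rfl, ?_⟩⟩
    · change F.VanishesAt (pluckerVector μ)
      rcases hF with hF | hF
      · obtain ⟨i, hi⟩ := mem_iUnion.1 hF
        exact grassmannPlucker_vanishesAt μ i hi
      · simp only [mem_iUnion] at hF
        obtain ⟨i, j, hij, hF⟩ := hF
        exact (incidencePlucker_vanishesAt_iff μ hij.ne).2 (h i j hij) F hF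
    · ext B
      exact (μ i).val_ne_top_iff B.1

end FlagDressian

/-! ### Matroid quotients and basis exchange -/

section Quotient

variable {α : Type*} {M N : Matroid α}

/-- The exchange property between the bases of `M` and of `N` that characterises matroid
quotients. -/
def BasisExchange (M N : Matroid α) : Prop :=
  ∀ I J : Set α, M.IsBase I → N.IsBase J → ∀ i ∈ I \ J, ∃ j ∈ J \ I,
    M.IsBase (insert j (I \ {i})) ∧ N.IsBase (insert i (J \ {j}))

/-- The set `X` of all possible `j` for the exchange in `J` spans `i` in `N`, hence in `M`; it is
not contained in the hyperplane of `M` spanned by `I \ i`. -/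
theorem IsQuotient.basisExchange [Finite α] (h : IsQuotient M N) : BasisExchange M N := by
  intro I J hI hJ i hi
  have hiM : i ∈ M.E := hI.subset_ground hi.1
  have hiN : i ∈ N.E := h.1 ▸ hiM
  set X : Set α := {j | j ∈ J ∧ N.IsBase (insert i (J \ {j}))} with hX
  have hXE : X ⊆ N.E := fun j hj => hJ.subset_ground hj.1
  have hiX : i ∈ N.closure X := by
    have hC := hJ.fundCircuit_isCircuit hiN hi.2
    refine N.closure_subset_closure ?_
      (hC.mem_closure_sdiff_singleton_of_mem (N.mem_fundCircuit i J))
    rintro x ⟨hx, hxi⟩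
    have hxJ : x ∈ J := (N.fundCircuit_subset_insert i J hx).resolve_left hxi
    rw [hJ.indep.mem_fundCircuit_iff (hJ.closure_eq ▸ hiN) hi.2] at hx
    exact ⟨hxJ, by
      rw [insert_sdiff_singleton_comm (Ne.symm hxi)]
      exact hJ.exchange_isBase_of_indep' hxJ hi.2 hx⟩
  have hiMX : i ∈ M.closure X := by
    by_contra hcon
    have h1 := M.eRk_insert_eq_add_one ⟨hiM, hcon⟩
    have h2 := h.2 X (insert i X) (subset_insert _ _) (insert_subset hiN hXE)
    have h3 : N.eRk (insert i X) = N.eRk X := by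
      rw [← N.eRk_closure_eq, N.closure_insert_eq_of_mem_closure hiX, N.eRk_closure_eq]
    rw [h1, h3] at h2
    have hMt : M.eRk X ≠ ⊤ :=
      ne_top_of_le_ne_top (Set.encard_ne_top_iff.2 X.toFinite) (M.eRk_le_encard X)
    have hNt : N.eRk X ≠ ⊤ :=
      ne_top_of_le_ne_top (Set.encard_ne_top_iff.2 X.toFinite) (N.eRk_le_encard X)
    lift M.eRk X to ℕ using hMt with a
    lift N.eRk X to ℕ using hNt with b
    norm_cast at h2
    omega
  have hnot : ¬ X ⊆ M.closure (I \ {i}) := fun hsub =>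
    hI.indep.notMem_closure_sdiff_of_mem hi.1
      (M.closure_subset_closure_of_subset_closure hsub hiMX)
  obtain ⟨j, hj, hjcl⟩ := not_subset.1 hnot
  have hjI : j ∉ I := fun hjI => hjcl (M.mem_closure_of_mem' (by
    refine ⟨hjI, ?_⟩
    rintro rfl
    exact hi.2 hj.1) (hI.subset_ground hjI))
  exact ⟨j, ⟨hj.1, hjI⟩,
    hI.exchange_base_of_notMem_closure hi.1 hjcl (h.1 ▸ hXE hj), hj.2⟩

theorem BasisExchange.mem_closure (h : BasisExchange M N) (hE : M.E = N.E) {A : Set α} {x : α}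
    (hA : A ⊆ N.E) (hx : x ∈ N.closure A) : x ∈ M.closure A := by
  have hxE : x ∈ M.E := hE ▸ N.closure_subset_ground A hx
  by_contra hcon
  have hxA : x ∉ A := fun hxA => hcon (M.mem_closure_of_mem hxA (hE ▸ hA))
  obtain ⟨K, hK⟩ := M.exists_isBasis A (hE ▸ hA)
  obtain ⟨L, hL⟩ := N.exists_isBasis A hA
  have hxK : M.Indep (insert x K) := by
    rw [hK.indep.insert_indep_iff, hK.closure_eq_closure]
    exact Or.inl ⟨hxE, hcon⟩
  obtain ⟨I, hI, hKI⟩ := hxK.exists_isBase_superset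
  obtain ⟨J, hJ, hLJ⟩ := hL.indep.exists_isBase_superset
  have hxL : x ∈ N.closure L := by rwa [hL.closure_eq_closure]
  have hspan : ∀ J', N.Indep J' → L ⊆ J' → x ∉ J' := fun J' hJ' hsub hxJ' =>
    hJ'.notMem_closure_sdiff_of_mem hxJ' (N.closure_subset_closure
      (subset_sdiff_singleton hsub fun h => hxA (hL.subset h)) hxL)
  obtain ⟨j, hj, hMj, hNj⟩ := h I J hI hJ x
    ⟨hKI (mem_insert _ _), hspan J hJ.indep hLJ⟩
  by_cases hjA : j ∈ A
  · refine hj.2 (hKI (Or.inr (hK.mem_of_insert_indep hjA (hMj.indep.subset ?_))))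
    exact insert_subset_insert (subset_sdiff_singleton ((subset_insert _ _).trans hKI)
      fun h => hxA (hK.subset h))
  · refine hspan _ hNj.indep ?_ (mem_insert _ _)
    exact (subset_sdiff_singleton hLJ fun h => hjA (hL.subset h)).trans (subset_insert _ _)

theorem BasisExchange.isQuotient (h : BasisExchange M N) (hE : M.E = N.E) : IsQuotient M N := by
  refine ⟨hE, fun A B hAB hB => ?_⟩
  obtain ⟨I, hI⟩ := N.exists_isBasis A (hAB.trans hB)
  obtain ⟨J, hJ, hIJ⟩ := hI.indep.subset_isBasis_of_subset (hI.subset.trans hAB) hB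
  -- `A` together with `J \ I` spans `B` in `N`, hence in `M`
  have hsub : B ⊆ M.closure (A ∪ (J \ I)) := by
    intro x hx
    refine h.mem_closure hE (union_subset (hAB.trans hB)
      (sdiff_subset.trans (hJ.subset.trans hB))) ?_
    have hx' : x ∈ N.closure J := by
      rw [hJ.closure_eq_closure]
      exact N.mem_closure_of_mem hx hB
    refine N.closure_subset_closure (fun y hy => ?_) hx'
    by_cases hyI : y ∈ I
    · exact Or.inl (hI.subset hyI)
    · exact Or.inr ⟨hy, hyI⟩
  have h1 : M.eRk B ≤ M.eRk A + (J \ I).encard :=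
    calc M.eRk B ≤ M.eRk (M.closure (A ∪ (J \ I))) := M.eRk_mono hsub
      _ = M.eRk (A ∪ (J \ I)) := M.eRk_closure_eq _
      _ ≤ _ := M.eRk_union_le_eRk_add_encard _ _
  rw [hI.eRk_eq_encard, hJ.eRk_eq_encard, ← encard_sdiff_add_encard_of_subset hIJ]
  calc M.eRk B + I.encard ≤ M.eRk A + (J \ I).encard + I.encard := by gcongr
    _ = _ := by ring

theorem IsQuotient.rank_le [Finite α] (h : IsQuotient M N) : rank M ≤ rank N := by
  have h1 := h.2 ∅ N.E (empty_subset _) subset_rfl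
  rw [M.eRk_empty, N.eRk_empty, N.eRk_ground, ← h.1, M.eRk_ground, add_zero, add_zero] at h1
  refine ENat.toNat_le_toNat h1 ?_
  obtain ⟨B, hB⟩ := N.exists_isBase
  rw [← hB.encard_eq_eRank]
  exact Set.encard_ne_top_iff.2 B.toFinite

end Quotient

/-! ### Initial matroids -/

section Initial

variable {α : Type*} [DecidableEq α]

/-- Exchange preserves the sum of the two weights, so that it passes to initial matroids. -/
theorem ValuatedExchange.isMinimizer {μ ν : ValuatedMatroid α} (h : ValuatedExchange μ ν)
    {u : α → ℝ} {I J : Finset α} (hI : μ.IsMinimizer u I) (hJ : ν.IsMinimizer u J) {i : α}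
    (hi : i ∈ I \ J) : ∃ j ∈ J \ I, μ.IsMinimizer u (insert j (I.erase i)) ∧
      ν.IsMinimizer u (insert i (J.erase j)) := by
  obtain ⟨j, hj, hle⟩ := h I J hI.1 hJ.1 i hi
  refine ⟨j, hj, ?_⟩
  rw [Finset.mem_sdiff] at hi hj
  have h1 := hI.2 (insert j (I.erase i))
  have h2 := hJ.2 (insert i (J.erase j))
  rw [sum_insert_erase hj.2 hi.1] at h1
  rw [sum_insert_erase hi.2 hj.1] at h2
  have hIt := μ.val_ne_top hI.1
  have hJt := ν.val_ne_top hJ.1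
  obtain ⟨h3, h4⟩ := ne_top_of_add_le hle hIt hJt
  refine ⟨⟨(μ.val_ne_top_iff _).1 h3, fun B' => le_trans ?_ (hI.2 B')⟩,
    ⟨(ν.val_ne_top_iff _).1 h4, fun B' => le_trans ?_ (hJ.2 B')⟩⟩
  · rw [sum_insert_erase hj.2 hi.1]
    lift μ.val I to ℝ using hIt with p
    lift ν.val J to ℝ using hJt with q
    lift μ.val (insert j (I.erase i)) to ℝ using h3 with r
    lift ν.val (insert i (J.erase j)) to ℝ using h4 with s
    norm_cast at *
    linarith
  · rw [sum_insert_erase hi.2 hj.1]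
    lift μ.val I to ℝ using hIt with p
    lift ν.val J to ℝ using hJt with q
    lift μ.val (insert j (I.erase i)) to ℝ using h3 with r
    lift ν.val (insert i (J.erase j)) to ℝ using h4 with s
    norm_cast at *
    linarith

theorem ValuatedExchange.exists_set_exchange {μ ν : ValuatedMatroid α} (h : ValuatedExchange μ ν)
    {u : α → ℝ} {I J : Set α} (hI : ∃ B : Finset α, μ.IsMinimizer u B ∧ (B : Set α) = I)
    (hJ : ∃ B : Finset α, ν.IsMinimizer u B ∧ (B : Set α) = J) {i : α} (hi : i ∈ I \ J) :
    ∃ j ∈ J \ I, (∃ B : Finset α, μ.IsMinimizer u B ∧ (B : Set α) = insert j (I \ {i})) ∧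
      ∃ B : Finset α, ν.IsMinimizer u B ∧ (B : Set α) = insert i (J \ {j}) := by
  obtain ⟨I, hI, rfl⟩ := hI
  obtain ⟨J, hJ, rfl⟩ := hJ
  obtain ⟨j, hj, h1, h2⟩ := h.isMinimizer hI hJ (i := i) (by simpa using hi)
  exact ⟨j, by simpa using hj, ⟨_, h1, by simp⟩, ⟨_, h2, by simp⟩⟩

/-- The initial matroid of `μ` for the weight vector `u`, whose bases are the bases of minimal
weight. -/
def ValuatedMatroid.initial [Finite α] (μ : ValuatedMatroid α) (u : α → ℝ) : Matroid α :=
  Matroid.ofIsBaseOfFinite (E := μ.matroid.E) (toFinite _)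
    (fun B => ∃ B' : Finset α, μ.IsMinimizer u B' ∧ (B' : Set α) = B)
    (by
      obtain ⟨B, hB⟩ := μ.exists_isMinimizer u
      exact ⟨_, B, hB, rfl⟩)
    (fun I J hI hJ i hi => by
      obtain ⟨j, hj, h1, -⟩ := (valuatedExchange_self μ).exists_set_exchange hI hJ hi
      exact ⟨j, hj, h1⟩)
    (by
      rintro _ ⟨B, hB, rfl⟩
      exact hB.1.subset_ground)

theorem ValuatedMatroid.initial_isBase_coe [Finite α] {μ : ValuatedMatroid α} {u : α → ℝ}
    {B : Finset α} : (μ.initial u).IsBase (B : Set α) ↔ μ.IsMinimizer u B := by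
  change (∃ B' : Finset α, μ.IsMinimizer u B' ∧ (B' : Set α) = B) ↔ _
  simp

theorem ValuatedExchange.isQuotient_initial [Finite α] {μ ν : ValuatedMatroid α}
    (h : ValuatedExchange μ ν) (hE : μ.matroid.E = ν.matroid.E) (u : α → ℝ) :
    IsQuotient (μ.initial u) (ν.initial u) :=
  BasisExchange.isQuotient (fun _ _ hI hJ _ hi => h.exists_set_exchange hI hJ hi) hE

theorem ValuatedMatroid.coe_weight (μ : ValuatedMatroid α) (B : Bases μ.matroid) :
    (μ.weight B : WithTop ℝ) = μ.val B.1 := WithTop.coe_untop _ _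

end Initial

/-! ### Faces of Minkowski sums -/

section Faces

theorem mem_coherentFace_sum_iff {k : ℕ} {A : Fin k → Type*} {E : Type*} [Fintype E]
    {a : ∀ i, A i → E → ℝ} {w : ∀ i, A i → ℝ} {u : E → ℝ} {x : ∀ i, A i} :
    x ∈ coherentFace (sumConfig a) (sumWeight w) u ↔
      ∀ i, x i ∈ coherentFace (a i) (w i) u := by
  have hsum : ∀ y : ∀ i, A i, u ⬝ᵥ sumConfig a y + sumWeight w y =
      ∑ i, (u ⬝ᵥ a i (y i) + w i (y i)) := by
    intro y
    rw [sumConfig, sumWeight, dotProduct_sum, ← Finset.sum_add_distrib]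
  constructor
  · intro hx i y
    have h := hx (Function.update x i y)
    rw [hsum, hsum, ← Finset.add_sum_erase _ _ (Finset.mem_univ i),
      ← Finset.add_sum_erase _ _ (Finset.mem_univ i)] at h
    have h' : ∑ j ∈ Finset.univ.erase i, (u ⬝ᵥ a j (Function.update x i y j) +
        w j (Function.update x i y j)) =
        ∑ j ∈ Finset.univ.erase i, (u ⬝ᵥ a j (x j) + w j (x j)) :=
      Finset.sum_congr rfl fun j hj => by
        rw [Function.update_of_ne (Finset.ne_of_mem_erase hj)]
    rw [h', Function.update_self] at h
    linarith
  · intro hx y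
    rw [hsum, hsum]
    exact Finset.sum_le_sum fun i _ => hx i (y i)

variable {α : Type*} [Fintype α]

theorem dotProduct_baseVector (M : Matroid α) (B : Bases M) (u : α → ℝ) :
    u ⬝ᵥ baseVector M B = ∑ e ∈ B.1, u e := by
  classical
  simp [dotProduct, baseVector, indicator_apply, Finset.sum_ite_mem]

variable [DecidableEq α]

theorem ValuatedMatroid.mem_coherentFace_iff {μ : ValuatedMatroid α} {u : α → ℝ}
    {B : Bases μ.matroid} :
    B ∈ coherentFace (baseVector μ.matroid) μ.weight u ↔ μ.IsMinimizer u B.1 := by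
  have hco : ∀ B : Bases μ.matroid, μ.val B.1 + (∑ e ∈ B.1, u e : ℝ) =
      ((u ⬝ᵥ baseVector μ.matroid B + μ.weight B : ℝ) : WithTop ℝ) := by
    intro B
    rw [dotProduct_baseVector, WithTop.coe_add, μ.coe_weight, add_comm]
  constructor
  · refine fun h => ⟨B.2, fun B' => ?_⟩
    by_cases hB' : μ.matroid.IsBase (B' : Set α)
    · rw [hco B, hco ⟨B', hB'⟩]
      exact WithTop.coe_le_coe.2 (h ⟨B', hB'⟩)
    · have : μ.val B' = ⊤ := by
        by_contra h'
        exact hB' ((μ.val_ne_top_iff B').1 h')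
      simp [this]
  · intro h B'
    have := h.2 B'.1
    rw [hco B, hco B'] at this
    exact WithTop.coe_le_coe.1 this

/-- The faces of the coherent subdivision are products of initial matroids, and the initial
matroids of a valuated flag matroid form a flag matroid. -/
theorem inducesFlagMatroidalSubdivision_of_valuatedExchange {n k : ℕ}
    {μ : Fin k → ValuatedMatroid (Fin n)} (hE : ∀ i, (μ i).matroid.E = univ)
    (h : ∀ i j, i < j → ValuatedExchange (μ i) (μ j)) : InducesFlagMatroidalSubdivision μ := by
  rintro _ ⟨u, rfl⟩
  refine ⟨k, fun i => (μ i).initial u, ⟨hE, fun i j hij =>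
    (h i j hij).isQuotient_initial ((hE i).trans (hE j).symm) u⟩, congrArg _ ?_⟩
  ext p
  constructor
  · rintro ⟨x, hx, rfl⟩
    have hx' := mem_coherentFace_sum_iff.1 hx
    exact ⟨fun i => ⟨(x i).1, ValuatedMatroid.initial_isBase_coe.2
      (ValuatedMatroid.mem_coherentFace_iff.1 (hx' i))⟩, rfl⟩
  · rintro ⟨x, rfl⟩
    have hx := fun i => ValuatedMatroid.initial_isBase_coe.1 (x i).2
    exact ⟨fun i => ⟨(x i).1, (hx i).1⟩, mem_coherentFace_sum_iff.2 fun i =>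
      ValuatedMatroid.mem_coherentFace_iff.2 (hx i), rfl⟩

end Faces

/-! ### Nested bases of flag matroids -/

section Nested

variable {n k : ℕ}

theorem sum_two_pow_injective :
    Function.Injective fun B : Finset (Fin n) => ∑ e ∈ B, (2 : ℝ) ^ (e : ℕ) := by
  intro B B' h
  have hsum : ∀ B : Finset (Fin n), ∑ e ∈ B, (2 : ℝ) ^ (e : ℕ) =
      ((∑ i ∈ B.map Fin.valEmbedding, 2 ^ i : ℕ) : ℝ) := by
    intro B
    rw [Finset.sum_map]
    push_cast
    rfl
  simp only [hsum, Nat.cast_inj] at h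
  exact Finset.map_injective _ (Finset.geomSum_injective le_rfl h)

/-- If all sets of elements have different weights, then the bases of minimal weight of the
constituents of a flag matroid form a chain: an exchange between two of them would again give
bases of minimal weight. -/
theorem IsFlagMatroid.exists_nested_of_injective {N : Fin k → Matroid (Fin n)}
    (hN : IsFlagMatroid N) {Γ : Type*} [AddCommGroup Γ] [LinearOrder Γ] [IsOrderedAddMonoid Γ]
    (g : Fin n → Γ) (hg : Function.Injective fun B : Finset (Fin n) => ∑ e ∈ B, g e) :
    ∃ y : ∀ i, Bases (N i), (∀ i, ∀ z : Bases (N i), ∑ e ∈ (y i).1, g e ≤ ∑ e ∈ z.1, g e) ∧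
      ∀ i j, i < j → (y i).1 ⊆ (y j).1 := by
  have hex : ∀ i, ∃ B : Bases (N i), ∀ z : Bases (N i), ∑ e ∈ B.1, g e ≤ ∑ e ∈ z.1, g e := by
    intro i
    have : Nonempty (Bases (N i)) := by
      obtain ⟨B, hB⟩ := exists_finset_isBase (N i)
      exact ⟨⟨B, hB⟩⟩
    exact Finite.exists_min fun B : Bases (N i) => ∑ e ∈ B.1, g e
  choose y hy using hex
  refine ⟨y, hy, fun i j hij a ha => ?_⟩
  by_contra haj
  obtain ⟨b, hb, hi', hj'⟩ := (hN.2 i j hij).basisExchange _ _ (y i).2 (y j).2 a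
    ⟨Finset.mem_coe.2 ha, fun h => haj (Finset.mem_coe.1 h)⟩
  have hbj : b ∈ (y j).1 := hb.1
  have hbi : b ∉ (y i).1 := hb.2
  have hi'' : (N i).IsBase ((insert b ((y i).1.erase a) : Finset (Fin n)) : Set (Fin n)) := by
    simpa using hi'
  have hj'' : (N j).IsBase ((insert a ((y j).1.erase b) : Finset (Fin n)) : Set (Fin n)) := by
    simpa using hj'
  have h1 := hy i ⟨_, hi''⟩
  have h2 := hy j ⟨_, hj''⟩
  simp only at h1 h2
  rw [sum_insert_erase hbi ha, add_sub_assoc, le_add_iff_nonneg_right, sub_nonneg] at h1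
  rw [sum_insert_erase haj hbj, add_sub_assoc, le_add_iff_nonneg_right, sub_nonneg] at h2
  have heq : insert b ((y i).1.erase a) = (y i).1 := hg (by
    simp only
    rw [sum_insert_erase hbi ha, le_antisymm h2 h1, add_sub_cancel_right])
  exact hbi (heq ▸ Finset.mem_insert_self _ _)

theorem dotProduct_baseConfig (N : Fin k → Matroid (Fin n)) (y : ∀ i, Bases (N i))
    (u : Fin n → ℝ) : u ⬝ᵥ baseConfig N y = ∑ i, ∑ e ∈ (y i).1, u e := by
  rw [baseConfig, sumConfig, dotProduct_sum]
  exact Finset.sum_congr rfl fun i _ => dotProduct_baseVector _ _ _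

/-- Ties between the values of the functional are broken lexicographically. -/
theorem IsFlagMatroid.exists_nested {N : Fin k → Matroid (Fin n)} (hN : IsFlagMatroid N)
    (u : Fin n → ℝ) : ∃ y : ∀ i, Bases (N i),
      (∀ z : ∀ i, Bases (N i), u ⬝ᵥ baseConfig N y ≤ u ⬝ᵥ baseConfig N z) ∧
      ∀ i j, i < j → (y i).1 ⊆ (y j).1 := by
  have hfst : ∀ B : Finset (Fin n), ofLex (∑ e ∈ B, toLex (u e, (2 : ℝ) ^ (e : ℕ))) =
      (∑ e ∈ B, u e, ∑ e ∈ B, (2 : ℝ) ^ (e : ℕ)) := by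
    intro B
    induction B using Finset.induction_on with
    | empty => rfl
    | insert a B ha ih =>
      rw [Finset.sum_insert ha, Finset.sum_insert ha, Finset.sum_insert ha, ofLex_add, ih]
      rfl
  obtain ⟨y, hy, hnest⟩ := hN.exists_nested_of_injective
    (fun e => toLex (u e, (2 : ℝ) ^ (e : ℕ))) (by
      intro B B' h
      have h' := congrArg ofLex h
      simp only [hfst] at h'
      exact sum_two_pow_injective (Prod.ext_iff.1 h').2)
  refine ⟨y, fun z => ?_, hnest⟩
  rw [dotProduct_baseConfig, dotProduct_baseConfig]
  refine Finset.sum_le_sum fun i _ => ?_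
  have h := Prod.Lex.monotone_fst _ _ (hy i (z i))
  rwa [hfst, hfst] at h

/-- The largest possible squared norm of `e_{B_1} + … + e_{B_k}` for sets of given sizes. -/
def nestedSqNorm (r : Fin k → ℕ) : ℝ := ∑ i, ∑ j, ((min (r i) (r j) : ℕ) : ℝ)

theorem baseConfig_dotProduct_self (N : Fin k → Matroid (Fin n)) (y : ∀ i, Bases (N i)) :
    baseConfig N y ⬝ᵥ baseConfig N y = ∑ i, ∑ j, (((y i).1 ∩ (y j).1).card : ℝ) := by
  rw [dotProduct_baseConfig]
  refine Finset.sum_congr rfl fun i _ => ?_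
  simp only [baseConfig, sumConfig, Finset.sum_apply]
  rw [Finset.sum_comm]
  refine Finset.sum_congr rfl fun j _ => ?_
  simp [baseVector, indicator_apply, Finset.sum_ite_mem]

theorem card_inter_le_min {N : Fin k → Matroid (Fin n)} (y : ∀ i, Bases (N i)) (i j : Fin k) :
    ((y i).1 ∩ (y j).1).card ≤ min (rank (N i)) (rank (N j)) := by
  rw [← card_eq_rank (y i).2, ← card_eq_rank (y j).2]
  exact le_min (Finset.card_le_card Finset.inter_subset_left)
    (Finset.card_le_card Finset.inter_subset_right)

theorem baseConfig_sqNorm_le (N : Fin k → Matroid (Fin n)) (y : ∀ i, Bases (N i)) :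
    baseConfig N y ⬝ᵥ baseConfig N y ≤ nestedSqNorm fun i => rank (N i) := by
  rw [baseConfig_dotProduct_self]
  exact Finset.sum_le_sum fun i _ => Finset.sum_le_sum fun j _ =>
    Nat.cast_le.2 (card_inter_le_min y i j)

theorem baseConfig_sqNorm_of_nested {N : Fin k → Matroid (Fin n)} {y : ∀ i, Bases (N i)}
    (hy : ∀ i j, i < j → (y i).1 ⊆ (y j).1) :
    baseConfig N y ⬝ᵥ baseConfig N y = nestedSqNorm fun i => rank (N i) := by
  rw [baseConfig_dotProduct_self]
  refine Finset.sum_congr rfl fun i _ => Finset.sum_congr rfl fun j _ => ?_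
  simp only [← card_eq_rank (y _).2]
  rcases lt_trichotomy i j with h | rfl | h
  · rw [Finset.inter_eq_left.2 (hy i j h), min_eq_left (Finset.card_le_card (hy i j h))]
  · simp
  · rw [Finset.inter_eq_right.2 (hy j i h), min_eq_right (Finset.card_le_card (hy j i h))]

theorem nested_of_baseConfig_sqNorm {N : Fin k → Matroid (Fin n)} {y : ∀ i, Bases (N i)}
    (h : baseConfig N y ⬝ᵥ baseConfig N y = nestedSqNorm fun i => rank (N i)) {i j : Fin k}
    (hij : rank (N i) ≤ rank (N j)) : (y i).1 ⊆ (y j).1 := by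
  rw [baseConfig_dotProduct_self, nestedSqNorm] at h
  have h1 := (Finset.sum_eq_sum_iff_of_le fun i _ => Finset.sum_le_sum fun j _ =>
    Nat.cast_le.2 (card_inter_le_min y i j)).1 h i (Finset.mem_univ _)
  have h2 := (Finset.sum_eq_sum_iff_of_le fun j _ =>
    Nat.cast_le.2 (card_inter_le_min y i j)).1 h1 j (Finset.mem_univ _)
  rw [Nat.cast_inj, min_eq_left hij, ← card_eq_rank (y i).2] at h2
  exact Finset.inter_eq_left.1 (Finset.eq_of_subset_of_card_le Finset.inter_subset_left h2.ge)

/-! ### Locally constant maximal norm on the faces of the subdivision -/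

theorem convexOn_dotProduct_self_sub (l : Fin n → ℝ) :
    ConvexOn ℝ univ fun v : Fin n → ℝ => v ⬝ᵥ v - l ⬝ᵥ v := by
  refine ⟨convex_univ, fun x _ y _ a b ha hb hab => ?_⟩
  simp only [dotProduct, Pi.add_apply, Pi.smul_apply, smul_eq_mul, ← Finset.sum_sub_distrib,
    Finset.mul_sum, ← Finset.sum_add_distrib]
  refine Finset.sum_le_sum fun e _ => ?_
  have hb' : b = 1 - a := by linarith
  subst hb'
  nlinarith [mul_nonneg (mul_nonneg ha hb) (sq_nonneg (x e - y e))]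

/-- Each face of the base polytope of a flag matroid contains a point of maximal norm of the
whole polytope. -/
theorem IsFlagMatroid.exists_mem_basePolytope {N : Fin k → Matroid (Fin n)}
    (hN : IsFlagMatroid N) (l : Fin n → ℝ) : ∃ p ∈ basePolytope N,
      (∀ p' ∈ basePolytope N, l ⬝ᵥ p ≤ l ⬝ᵥ p') ∧ ∀ p' ∈ basePolytope N, p' ⬝ᵥ p' ≤ p ⬝ᵥ p := by
  obtain ⟨y, hy, hnest⟩ := hN.exists_nested l
  refine ⟨baseConfig N y, subset_convexHull _ _ (mem_range_self y), fun p' hp' => ?_,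
    fun p' hp' => ?_⟩
  · have hlin : ConvexOn ℝ univ fun v : Fin n → ℝ => -(l ⬝ᵥ v) := by
      refine ⟨convex_univ, fun x _ y _ a b _ _ _ => le_of_eq ?_⟩
      simp only [dotProduct_add, dotProduct_smul, smul_eq_mul]
      ring
    obtain ⟨_, ⟨z, rfl⟩, hz⟩ := hlin.exists_ge_of_mem_convexHull
      (subset_univ _) (x := p') (t := range (baseConfig N)) hp'
    linarith [hy z]
  · obtain ⟨_, ⟨z, rfl⟩, hz⟩ := (convexOn_dotProduct_self_sub 0).exists_ge_of_mem_convexHull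
      (subset_univ _) (x := p') (t := range (baseConfig N)) hp'
    simp only [zero_dotProduct, sub_zero] at hz
    rw [baseConfig_sqNorm_of_nested hnest]
    exact hz.trans (baseConfig_sqNorm_le N z)

variable {A : Type*} {a : A → Fin n → ℝ} {w : A → ℝ}

theorem isClosed_setOf_mem_coherentFace (a : A → Fin n → ℝ) (w : A → ℝ) (x : A) :
    IsClosed {u | x ∈ coherentFace a w u} := by
  have : {u | x ∈ coherentFace a w u} = ⋂ y, {u | u ⬝ᵥ a x + w x ≤ u ⬝ᵥ a y + w y} := by
    ext u
    simp [coherentFace]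
  rw [this]
  exact isClosed_iInter fun y => isClosed_le (by fun_prop) (by fun_prop)

theorem coherentFace_nonempty [Finite A] [Nonempty A] (a : A → Fin n → ℝ) (w : A → ℝ)
    (u : Fin n → ℝ) : (coherentFace a w u).Nonempty :=
  Finite.exists_min fun x => u ⬝ᵥ a x + w x

/-- If in every cell of a coherent subdivision each face contains a point of maximal norm of the
cell, then the maximal norm is the same for all cells. The set of `u` whose cell contains a point
of norm square `K` is open, because for `u` near `u₀` the cell of `u` is the face of the cell of
`u₀` in direction `u - u₀`, and `ℝⁿ` is connected. -/
theorem exists_sqNorm_eq_of_coherentFace [Finite A]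
    (hface : ∀ u l : Fin n → ℝ, ∃ p ∈ convexHull ℝ (a '' coherentFace a w u),
      (∀ p' ∈ convexHull ℝ (a '' coherentFace a w u), l ⬝ᵥ p ≤ l ⬝ᵥ p') ∧
      ∀ p' ∈ convexHull ℝ (a '' coherentFace a w u), p' ⬝ᵥ p' ≤ p ⬝ᵥ p)
    {K : ℝ} (hK : ∀ x, a x ⬝ᵥ a x ≤ K) {u₁ : Fin n → ℝ} {x₁ : A}
    (hx₁ : x₁ ∈ coherentFace a w u₁) (hx₁K : a x₁ ⬝ᵥ a x₁ = K) (u : Fin n → ℝ) :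
    ∃ x ∈ coherentFace a w u, a x ⬝ᵥ a x = K := by
  set U : Set (Fin n → ℝ) := {u | ∃ x ∈ coherentFace a w u, a x ⬝ᵥ a x = K} with hU
  suffices h : U = univ from (h ▸ mem_univ u : u ∈ U)
  have hclosed : IsClosed U := by
    have : U = ⋃ x ∈ {x | a x ⬝ᵥ a x = K}, {u | x ∈ coherentFace a w u} := by
      ext u
      simp only [hU, mem_ofPred_eq, mem_iUnion, exists_prop]
      exact exists_congr fun x => and_comm
    rw [this]
    exact (toFinite _).isClosed_biUnion fun x _ => isClosed_setOf_mem_coherentFace a w x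
  have hopen : IsOpen U := by
    rw [isOpen_iff_mem_nhds]
    rintro u₀ ⟨x₀, hx₀, hx₀K⟩
    have hnear : ∀ᶠ u in nhds u₀, ∀ y, y ∉ coherentFace a w u₀ → y ∉ coherentFace a w u :=
      Filter.eventually_all.2 fun y => by
        by_cases hy : y ∈ coherentFace a w u₀
        · simp [hy]
        · filter_upwards [(isClosed_setOf_mem_coherentFace a w y).isOpen_compl.mem_nhds hy]
            with u hu _ using hu
    filter_upwards [hnear] with u hu
    obtain ⟨p, hp, hpl, hpq⟩ := hface u₀ (u - u₀)
    have hmem : ∀ x ∈ coherentFace a w u₀, a x ∈ convexHull ℝ (a '' coherentFace a w u₀) :=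
      fun x hx => subset_convexHull _ _ (mem_image_of_mem a hx)
    obtain ⟨_, ⟨x, hx, rfl⟩, hxp⟩ :=
      (convexOn_dotProduct_self_sub (u - u₀)).exists_ge_of_mem_convexHull (subset_univ _) hp
    have h1 := hpq _ (hmem x₀ hx₀)
    have h2 := hpl _ (hmem x hx)
    have h3 := hK x
    refine ⟨x, fun z => ?_, by linarith⟩
    have : Nonempty A := ⟨x⟩
    obtain ⟨y, hy⟩ := coherentFace_nonempty a w u
    have hy₀ : y ∈ coherentFace a w u₀ := by
      by_contra h
      exact hu y h hy
    have h4 := hpl _ (hmem y hy₀)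
    have h5 := hx y
    have h6 := hy z
    rw [sub_dotProduct, sub_dotProduct] at *
    linarith
  exact IsClopen.eq_univ ⟨hclosed, hopen⟩ ⟨u₁, x₁, hx₁, hx₁K⟩

/-- Far away in a generic direction the cells are chains of bases of the underlying flag
matroid. -/
theorem exists_nested_mem_coherentFace {μ : Fin k → ValuatedMatroid (Fin n)}
    (hM : IsFlagMatroid fun i => (μ i).matroid) :
    ∃ (u : Fin n → ℝ) (y : ∀ i, Bases (μ i).matroid),
      y ∈ coherentFace (baseConfig fun i => (μ i).matroid) (sumWeight fun i => (μ i).weight) u ∧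
      ∀ i j, i < j → (y i).1 ⊆ (y j).1 := by
  obtain ⟨y, hy, hnest⟩ := hM.exists_nested_of_injective (fun e => (2 : ℝ) ^ (e : ℕ))
    sum_two_pow_injective
  have hev : ∀ᶠ t : ℝ in Filter.atTop, ∀ i, ∀ z : Bases (μ i).matroid,
      t * ∑ e ∈ (y i).1, (2 : ℝ) ^ (e : ℕ) + (μ i).weight (y i) ≤
        t * ∑ e ∈ z.1, (2 : ℝ) ^ (e : ℕ) + (μ i).weight z := by
    refine Filter.eventually_all.2 fun i => Filter.eventually_all.2 fun z => ?_
    rcases (hy i z).lt_or_eq with hlt | heq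
    · filter_upwards [Filter.eventually_ge_atTop (((μ i).weight (y i) - (μ i).weight z) /
        (∑ e ∈ z.1, (2 : ℝ) ^ (e : ℕ) - ∑ e ∈ (y i).1, (2 : ℝ) ^ (e : ℕ)))] with t ht
      rw [div_le_iff₀ (by linarith)] at ht
      linarith
    · have : y i = z := Subtype.ext (sum_two_pow_injective heq)
      subst this
      exact Filter.Eventually.of_forall fun t => le_rfl
  obtain ⟨t, ht⟩ := hev.exists
  refine ⟨fun e => t * 2 ^ (e : ℕ), y, mem_coherentFace_sum_iff.2 fun i z => ?_, hnest⟩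
  rw [dotProduct_baseVector, dotProduct_baseVector, ← Finset.mul_sum, ← Finset.mul_sum]
  exact ht i z

theorem InducesFlagMatroidalSubdivision.exists_nested {μ : Fin k → ValuatedMatroid (Fin n)}
    (hM : IsFlagMatroid fun i => (μ i).matroid) (h : InducesFlagMatroidalSubdivision μ)
    (u : Fin n → ℝ) : ∃ y : ∀ i, Bases (μ i).matroid,
      (∀ i, y i ∈ coherentFace (baseVector (μ i).matroid) (μ i).weight u) ∧
      ∀ i j, i < j → (y i).1 ⊆ (y j).1 := by
  obtain ⟨u₁, x₁, hx₁, hnest⟩ := exists_nested_mem_coherentFace hM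
  obtain ⟨y, hy, hyK⟩ := exists_sqNorm_eq_of_coherentFace (fun u l => by
    obtain ⟨m, N, hN, hconv⟩ := h _ ⟨u, rfl⟩
    rw [hconv]
    exact hN.exists_mem_basePolytope l) (baseConfig_sqNorm_le fun i => (μ i).matroid) hx₁
    (baseConfig_sqNorm_of_nested hnest) u
  exact ⟨y, mem_coherentFace_sum_iff.1 hy, fun i j hij =>
    nested_of_baseConfig_sqNorm hyK (hM.2 i j hij).rank_le⟩

end Nested

/-! ### From nested initial bases to tropical linear spaces -/

section Limit

variable {n : ℕ}

/-- A non-loop `e` of an initial matroid of `μ` is a non-loop of that of `ν`: lowering the weight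
of `e` by `ε > 0` forces `e` into all bases of the initial matroid of `μ`, and `ε` may tend
to `0`. -/
theorem exists_isMinimizer_mem_of_nested {μ ν : ValuatedMatroid (Fin n)}
    (h : ∀ u : Fin n → ℝ, ∃ I ∈ coherentFace (baseVector μ.matroid) μ.weight u,
      ∃ J ∈ coherentFace (baseVector ν.matroid) ν.weight u, I.1 ⊆ J.1)
    {u : Fin n → ℝ} {e : Fin n} {I : Finset (Fin n)} (hI : μ.IsMinimizer u I) (he : e ∈ I) :
    ∃ J, ν.IsMinimizer u J ∧ e ∈ J := by
  set U : Set (Fin n → ℝ) :=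
    ⋃ J ∈ {J : Bases ν.matroid | e ∈ J.1}, {u | J ∈ coherentFace (baseVector ν.matroid) ν.weight u}
    with hU
  have hclosed : IsClosed U :=
    (toFinite _).isClosed_biUnion fun J _ => isClosed_setOf_mem_coherentFace _ _ J
  have hlim : Filter.Tendsto (fun ε : ℝ => u - ε • Pi.single e 1) (nhdsWithin 0 (Ioi 0))
      (nhds u) := by
    have hc : Continuous fun ε : ℝ => u - ε • (Pi.single e 1 : Fin n → ℝ) := by fun_prop
    have := hc.tendsto 0
    rw [zero_smul, sub_zero] at this
    exact this.mono_left nhdsWithin_le_nhds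
  have hmem : u ∈ U := by
    refine hclosed.mem_of_tendsto hlim ?_
    filter_upwards [self_mem_nhdsWithin] with ε hε
    obtain ⟨K, hK, J, hJ, hKJ⟩ := h (u - ε • Pi.single e 1)
    refine mem_iUnion₂.2 ⟨J, hKJ ?_, hJ⟩
    by_contra heK
    have h1 := hK ⟨I, hI.1⟩
    have h2 := (ValuatedMatroid.mem_coherentFace_iff (B := ⟨I, hI.1⟩)).2 hI K
    have hdot : ∀ B : Bases μ.matroid, (Pi.single e 1 : Fin n → ℝ) ⬝ᵥ baseVector μ.matroid B =
        if e ∈ B.1 then 1 else 0 := by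
      intro B
      simp [baseVector, indicator_apply]
    rw [sub_dotProduct, sub_dotProduct, smul_dotProduct, smul_dotProduct, hdot, hdot, if_neg heK,
      if_pos he] at h1
    simp only [smul_eq_mul, mul_zero, mul_one, sub_zero] at h1
    have : 0 < ε := hε
    linarith
  obtain ⟨J, hJ, hJu⟩ := mem_iUnion₂.1 hmem
  exact ⟨J.1, ValuatedMatroid.mem_coherentFace_iff.1 hJu, hJ⟩

/-- The infinite coordinates of `u` are replaced by a large real number `t`. Orthogonality of `u`
to the circuits of `μ` still shows that the initial matroid of `μ` for this weight has no loops in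
the support of `u`. -/
theorem CircuitOrthogonal.of_nested {μ ν : ValuatedMatroid (Fin n)}
    (h : ∀ u : Fin n → ℝ, ∃ I ∈ coherentFace (baseVector μ.matroid) μ.weight u,
      ∃ J ∈ coherentFace (baseVector ν.matroid) ν.weight u, I.1 ⊆ J.1)
    {u : Fin n → WithTop ℝ} (hu : CircuitOrthogonal μ u) : CircuitOrthogonal ν u := by
  intro B hB e heB hue
  -- `t` is so large that the new coordinates cannot attain the minimum over the circuit
  obtain ⟨t, ht⟩ : ∃ t : ℝ, ∀ f ∈ B, ∀ r : ℝ, ν.val (insert e (B.erase f)) = r →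
      ν.val B + u e < r + t := by
    have hBt := ν.val_ne_top hB
    lift ν.val B to ℝ using hBt with p
    lift u e to ℝ using hue with q
    obtain ⟨M, hM⟩ :=
      (B.image fun f => p + q - (ν.val (insert e (B.erase f))).untopD 0).bddAbove
    refine ⟨M + 1, fun f hf r hr => ?_⟩
    have := hM (Finset.mem_coe.2 (Finset.mem_image_of_mem _ hf))
    rw [hr, WithTop.untopD_coe] at this
    norm_cast
    linarith
  set x : Fin n → ℝ := fun a => (u a).untopD t with hx
  have hxu : ∀ a, u a ≠ ⊤ → (x a : WithTop ℝ) = u a := by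
    intro a ha
    simp only [hx]
    lift u a to ℝ using ha with r
    simp
  obtain ⟨I, hI, heI⟩ := μ.exists_isMinimizer_mem x e fun K hK heK => by
    obtain ⟨f, hf, hle⟩ := hu K hK.1 e heK hue
    have hft := (ne_top_of_add_le hle (μ.val_ne_top hK.1) hue).2
    exact ⟨f, hf, by rwa [hxu f hft, hxu e hue]⟩
  obtain ⟨J, hJ, heJ⟩ := exists_isMinimizer_mem_of_nested h hI heI
  obtain ⟨f, hf, hle⟩ := (valuatedExchange_self ν).exists_le_of_cocircuit
    (u := fun a => (x a : WithTop ℝ)) WithTop.coe_ne_top hJ.1 heJ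
    (fun a ha => hJ.val_add_le heJ ha) hB heB
  simp only [hxu e hue] at hle
  refine ⟨f, hf, ?_⟩
  by_cases hft : u f = ⊤
  · have hval := (ne_top_of_add_le hle (ν.val_ne_top hB) hue).1
    have hlt := ht f hf _ (WithTop.coe_untop _ hval).symm
    rw [WithTop.coe_untop] at hlt
    simp only [hx, hft, WithTop.untopD_top] at hle
    exact absurd hle (not_le_of_gt hlt)
  · rwa [hxu f hft] at hle

end Limit

end FlagTrop

theorem theoremA {n k : ℕ} (μ : Fin k → FlagTrop.ValuatedMatroid (Fin n))
    (hM : FlagTrop.IsFlagMatroid fun i => (μ i).matroid) :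
    List.TFAE [
      (fun i => (μ i).toProj) ∈ FlagTrop.flagDressianOf fun i => (μ i).matroid,
      FlagTrop.IsValuatedFlagMatroid μ,
      FlagTrop.InducesFlagMatroidalSubdivision μ,
      ∀ i j : Fin k, i ≤ j → (μ i).projTrop ⊆ (μ j).projTrop] := by
  have hE : ∀ i, (μ i).matroid.E = univ := hM.1
  -- all conditions except for the third one are compared with the pairwise exchange property
  have ha := FlagTrop.toProj_mem_flagDressianOf_iff μ
  have hb : FlagTrop.IsValuatedFlagMatroid μ ↔
      ∀ i j, i < j → FlagTrop.ValuatedExchange (μ i) (μ j) :=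
    ⟨fun h i j hij => (h.2 i j hij).2.2, fun h => ⟨hE, fun i j hij =>
      ⟨(hE i).trans (hE j).symm, (hM.2 i j hij).rank_le, h i j hij⟩⟩⟩
  tfae_have 1 ↔ 2 := ha.trans hb.symm
  tfae_have 2 → 3 := fun h =>
    FlagTrop.inducesFlagMatroidalSubdivision_of_valuatedExchange hE (hb.1 h)
  tfae_have 3 → 4 := by
    intro h i j hij
    rcases hij.eq_or_lt with rfl | hlt
    · exact subset_rfl
    rw [FlagTrop.projTrop_subset_iff (hE i) (hE j)]
    intro u _ hu
    refine hu.of_nested fun v => ?_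
    obtain ⟨y, hy, hnest⟩ := h.exists_nested hM v
    exact ⟨y i, hy i, y j, hy j, hnest i j hlt⟩
  tfae_have 4 → 2 := fun h => hb.2 fun i j hij => FlagTrop.valuatedExchange_of_circuitOrthogonal
    ((FlagTrop.projTrop_subset_iff (hE i) (hE j)).1 (h i j hij.le))
  tfae_finish
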